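/- **Global convergence of RSHTR to an $\varepsilon$-approximate first-order stationary point.** *Algorithm.* Let $f:\mathbb{R}^n\to\mathbb{R}$ be $C^2$ and bounded below, let $1\le s\le n$, $\delta>0$, $\Delta>0$ and $x_0\in\mathbb{R}^n$. At iteration $k=0,1,2,\dots$, RSHTR draws, independently of the past, an $s\times n$ matrix $P_k$ with independent $\mathcal N(0,1/s)$ entries, and computes an optimal solution $[\tilde v_k;t_k]\in\mathbb{R}^{s}\times\mathbb{R}$ of $$\min_{\|[\tilde v;t]\|\le 1}\begin{bmatrix}\tilde v\\ t\end{bmatrix}^{\top}\begin{bmatrix}P_k\nabla^2 f(x_k)P_k^{\top} & P_k\nabla f(x_k)\\ (P_k\nabla f(x_k))^{\top} & -\delta\end{bmatrix}\begin{bmatrix}\tilde v\\ t\end{bmatrix}.$$ It sets $d_k=P_k^{\top}\tilde v_k/t_k$ if $t_k\ne 0$ and $d_k=P_k^{\top}\tilde v_k$ if $t_k=0$. If $\|d_k\|>\Delta$, then $x_{k+1}=x_k+(\Delta/\|d_k\|)\,d_k$. If $\|d_k\|\le\Delta$, the method stops at iteration $k$ with output $x_k$; in this case put $x_{k+1}=x_k+d_k$.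 *Theorem.* There are absolute constants $\mathcal C>0$ and $C>0$ such that for all $L,M\ge 0$, $c>0$, $\tau>0$ there is a constant $K>0$, depending only on $L,M,c,\tau$, with the following property. Let $1\le s\le n$, let $f:\mathbb{R}^n\to\mathbb{R}$ be $C^2$ and bounded below, with $L$-Lipschitz gradient and $M$-Lipschitz Hessian (in operator norm), and let $x_0\in\mathbb{R}^n$. Let $$0<\varepsilon\le \frac{M^2}{8},\qquad \delta=\Big(\sqrt{\tfrac{n}{s}}+\mathcal C\Big)^2\sqrt{\varepsilon},\qquad \Delta=\frac{\sqrt{\varepsilon}}{M},\qquad s\le c\,n\,\varepsilon^{1/\tau},$$ and put $U_\varepsilon=\lfloor 3M^2\,(f(x_0)-\inf f)\,\varepsilon^{-3/2}\rfloor+1$. Then $$U_\varepsilon\le\Big(3M^2(f(x_0)-\inf f)+(M^2/8)^{3/2}\Big)\varepsilon^{-3/2}=O(\varepsilon^{-3/2}),$$ and with probability at least $$1-4\exp(-Cs/4)-(2U_\varepsilon+2)\exp(-s)$$ RSHTR started at $x_0$ stops within its first $U_\varepsilon$ iterations, and, if $k$ denotes the iteration at which it stops, its output is a first-order stationary point of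 accuracy $O(\varepsilon)$ in the sense that $$\|\nabla f(x_k)\|\le K\Big(\frac{n}{s}\Big)^{(2+\tau)/2}\varepsilon ;$$ the same bound holds for $\|\nabla f(x_{k+1})\|$, where $x_{k+1}=x_k+d_k$. -/

import Mathlib

open MeasureTheory ProbabilityTheory
open scoped Matrix NNReal

namespace RSHTR

noncomputable section

/-- The Euclidean space `ℝⁿ`. -/
abbrev E (n : ℕ) : Type := EuclideanSpace ℝ (Fin n)

/-- The space `ℝˢ × ℝ = ℝˢ⁺¹` of pairs `[ṽ; t]`, with its Euclidean norm. -/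
abbrev Hom (s : ℕ) : Type := EuclideanSpace ℝ (Fin s ⊕ Unit)

/-- The Hessian matrix `∇²f(x)`, i.e. the matrix of the derivative of `∇f` at `x`. -/
def hessian {n : ℕ} (f : E n → ℝ) (x : E n) : Matrix (Fin n) (Fin n) ℝ :=
  Matrix.of fun i j => fderiv ℝ (gradient f) x (EuclideanSpace.single j 1) i

/-- Real matrices carry the product `σ`-algebra of their entries. -/
instance instMeasurableSpaceMatrix (s n : ℕ) :
    MeasurableSpace (Matrix (Fin s) (Fin n) ℝ) :=
  inferInstanceAs (MeasurableSpace (Fin s → Fin n → ℝ))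

/-- The law of an `s × n` random matrix with independent `𝒩(0, 1/s)` entries. -/
def gaussianMatrix (s n : ℕ) : Measure (Matrix (Fin s) (Fin n) ℝ) :=
  (Measure.pi fun _ : Fin s => Measure.pi fun _ : Fin n =>
    gaussianReal 0 ((s : ℝ≥0)⁻¹)).map Matrix.of

/-- The matrix `[H̃, g̃; g̃ᵀ, -δ]` of the reduced homogenized model at `x`, where
`g̃ = P ∇f(x)` and `H̃ = P ∇²f(x) Pᵀ`. -/
def modelMatrix {s n : ℕ} (f : E n → ℝ) (δ : ℝ) (x : E n) (P : Matrix (Fin s) (Fin n) ℝ) :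
    Matrix (Fin s ⊕ Unit) (Fin s ⊕ Unit) ℝ :=
  Matrix.fromBlocks
    (P * hessian f x * Pᵀ)
    (Matrix.of fun i _ => (P *ᵥ (gradient f x).ofLp) i)
    (Matrix.of fun _ j => (P *ᵥ (gradient f x).ofLp) j)
    (Matrix.of fun _ _ => -δ)

/-- `y = [ṽ; t]` is an optimal solution of the reduced subproblem
`min { yᵀ F y : ‖y‖ ≤ 1 }`, where `F` is the matrix of the reduced model. -/
def IsSubproblemSolution {s n : ℕ} (f : E n → ℝ) (δ : ℝ) (x : E n)
    (P : Matrix (Fin s) (Fin n) ℝ) (y : Hom s) : Prop :=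
  y ∈ Metric.closedBall (0 : Hom s) 1 ∧
    IsMinOn (fun z : Hom s => z.ofLp ⬝ᵥ (modelMatrix f δ x P *ᵥ z.ofLp))
      (Metric.closedBall (0 : Hom s) 1) y

/-- The search direction: `Pᵀ ṽ / t` if `t ≠ 0`, and `Pᵀ ṽ` if `t = 0`, for `y = [ṽ; t]`. -/
def direction {s n : ℕ} (P : Matrix (Fin s) (Fin n) ℝ) (y : Hom s) : E n :=
  let v : Fin s → ℝ := fun i => y (Sum.inl i)
  let t : ℝ := y (Sum.inr ())
  if t ≠ 0 then t⁻¹ • WithLp.toLp 2 (Pᵀ *ᵥ v) else WithLp.toLp 2 (Pᵀ *ᵥ v)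

/-- The fixed-radius update: `x + (Δ / ‖d‖) d` if `‖d‖ > Δ`, and `x + d` if `‖d‖ ≤ Δ`. -/
def nextIterate {n : ℕ} (Δ : ℝ) (x d : E n) : E n :=
  if Δ < ‖d‖ then x + (Δ / ‖d‖) • d else x + d

/-- A run of the method with parameters `s, δ, Δ`, from `x₀`, on a probability space with a
filtration `ℱ`, where `ℱ k` carries the information available before iteration `k`.
At iteration `k` a fresh Gaussian matrix `P k`, independent of `ℱ k`, is drawn, an arbitrary
(possibly randomized) exact solver returns a solution `y k = [ṽₖ; tₖ]` of the reduced subproblem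
at `x k`, and the iterate is updated along the resulting direction. -/
structure IsRun {Ω : Type*} [mΩ : MeasurableSpace Ω] (μ : Measure Ω) (ℱ : Filtration ℕ mΩ)
    {s n : ℕ} (f : E n → ℝ) (δ Δ : ℝ) (x₀ : E n)
    (P : ℕ → Ω → Matrix (Fin s) (Fin n) ℝ) (y : ℕ → Ω → Hom s) (x : ℕ → Ω → E n) : Prop where
  measurable_matrix : ∀ k, Measurable[ℱ (k + 1)] (P k)
  law_matrix : ∀ k, μ.map (P k) = gaussianMatrix s n
  indep_matrix : ∀ k, Indep (MeasurableSpace.comap (P k) inferInstance) (ℱ k) μ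
  measurable_solution : ∀ k, Measurable[ℱ (k + 1)] (y k)
  solution : ∀ k, ∀ᵐ ω ∂μ, IsSubproblemSolution f δ (x k ω) (P k ω) (y k ω)
  init : ∀ ω, x 0 ω = x₀
  step : ∀ k ω, x (k + 1) ω = nextIterate Δ (x k ω) (direction (P k ω) (y k ω))

/-- The method stops at iteration `k` (counted from `0`): this is the first iteration whose
direction satisfies `‖dₖ‖ ≤ Δ`. -/
def StopsAt {s n : ℕ} (Δ : ℝ) (P : ℕ → Matrix (Fin s) (Fin n) ℝ) (y : ℕ → Hom s)
    (k : ℕ) : Prop :=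
  (∀ j < k, Δ < ‖direction (P j) (y j)‖) ∧ ‖direction (P k) (y k)‖ ≤ Δ

/-- The iteration bound `⌊3 M² (f(x₀) - inf f) ε^{-3/2}⌋ + 1`. -/
def iterBound {n : ℕ} (f : E n → ℝ) (x₀ : E n) (M ε : ℝ) : ℕ :=
  ⌊3 * M ^ 2 * (f x₀ - ⨅ z, f z) * ε ^ (-(3 / 2) : ℝ)⌋₊ + 1

end

end RSHTR

/-! Write `T = Pᵀ`, `R = √(n/s) + 336` and `g = ∇f(x_k)`. Call an iteration good if `‖T‖ ≤ R`, `‖P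
g‖ ≥ ‖g‖ / 10` and `‖Pᵀ P g‖ ≥ (2/5) ‖P g‖`. On good iterations everything is deterministic. The
subproblem has a multiplier `θ ≥ δ = R² √ε` (`exists_multiplier`).

Long steps: `θ ‖w‖² ≥ √ε ‖T w‖²`, so a step of length `Δ` lowers the quadratic model by at least `√ε
Δ² / 2` (`model_decrease`). The cubic error `M Δ³ / 6` still leaves a decrease of `ε^{3/2} / (3
M²)`, so fewer than `U_ε` consecutive steps from `x₀` can be long (`exists_short_direction`).

Short steps: for `t ≠ 0`, stationarity says that `P g` equals `-P H d - θ w` with `d = T w`.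
Applying `T` makes every term on the right of size `Δ`, so `‖Pᵀ P g‖`, and hence `‖g‖`, is `O(R² Δ)`
(`sketched_gradient_le`); the case `t = 0` is separate. This is of order `(n/s) √ε`, and `s ≤ c n
ε^{1/τ}` trades `√ε` for `(n/s)^{τ/2} ε` (`sqrt_le_of_le_mul_rpow`).

Probability: the bound on `‖T‖` comes from chi-square tails and a net (`exists_norm_transpose_le`).
The two lower bounds concern one vector `g`, which is independent of the fresh `P`; rotation
invariance reduces them to chi-square tails (`gaussianMatrix_sketchFailure_le`). For `s ≥ 6` an
iteration fails with probability at most `2 exp(-s)`, and a union bound over `U_ε` iterations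
finishes. For `s < 6` the claimed probability is negative. -/

namespace RSHTR

/-! ### Deterministic analysis of one homogenized subproblem, and the cubic Taylor bound. -/

section Deterministic

variable {V F : Type*} [NormedAddCommGroup V] [InnerProductSpace ℝ V]
  [NormedAddCommGroup F] [InnerProductSpace ℝ F]

/-- The homogenized quadratic model at `[a; b]`, pulled back along the linear map `T`. -/
def homModel (T : V →ₗ[ℝ] F) (B : F →L[ℝ] F) (g : F) (δ : ℝ) (a : V) (b : ℝ) : ℝ :=
  inner ℝ (B (T a)) (T a) + 2 * b * inner ℝ g (T a) - δ * b ^ 2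

/-- Turns nonnegativity of the regularized model along lines into first-order conditions. -/
theorem eq_zero_of_forall_linear_add_quadratic_nonneg {p r : ℝ}
    (h : ∀ τ : ℝ, 0 ≤ τ * p + τ ^ 2 * r) : p = 0 := by
  by_contra hp
  have hr : 0 < |r| + 1 := by positivity
  have h1 := h (-p / (|r| + 1))
  have h2 : -p / (|r| + 1) * p + (-p / (|r| + 1)) ^ 2 * r
      = p ^ 2 / (|r| + 1) ^ 2 * (r - (|r| + 1)) := by
    field_simp
    ring
  rw [h2] at h1
  have h3 : 0 < p ^ 2 / (|r| + 1) ^ 2 := by positivity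
  nlinarith [le_abs_self r]

theorem homModel_smul (T : V →ₗ[ℝ] F) (B : F →L[ℝ] F) (g : F) (δ : ℝ) (c : ℝ) (a : V) (b : ℝ) :
    homModel T B g δ (c • a) (c * b) = c ^ 2 * homModel T B g δ a b := by
  simp only [homModel, map_smul, inner_smul_left, inner_smul_right, RCLike.conj_to_real]
  ring

theorem homModel_add {T : V →ₗ[ℝ] F} {B : F →L[ℝ] F} (g : F) (δ θ : ℝ)
    (hB : ∀ u w, inner ℝ (B u) w = inner ℝ u (B w)) (v a : V) (t b τ : ℝ) :
    homModel T B g δ (v + τ • a) (t + τ * b) + θ * (‖v + τ • a‖ ^ 2 + (t + τ * b) ^ 2) =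
      (homModel T B g δ v t + θ * (‖v‖ ^ 2 + t ^ 2)) +
      τ * (2 * (inner ℝ (B (T v)) (T a) + t * inner ℝ g (T a) + b * inner ℝ g (T v) - δ * t * b
        + θ * (inner ℝ v a + t * b))) +
      τ ^ 2 * (homModel T B g δ a b + θ * (‖a‖ ^ 2 + b ^ 2)) := by
  have h1 : inner ℝ (B (T a)) (T v) = inner ℝ (B (T v)) (T a) := by
    rw [hB, real_inner_comm]
  simp only [homModel, map_add, map_smul, inner_add_left, inner_add_right, inner_smul_left,
    inner_smul_right, RCLike.conj_to_real, ← real_inner_self_eq_norm_sq, h1,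
    real_inner_comm v a]
  ring

/-- The optimality conditions of the homogenized trust-region subproblem. -/
theorem exists_multiplier {T : V →ₗ[ℝ] F} {B : F →L[ℝ] F} {g : F} {δ : ℝ} {v : V} {t : ℝ}
    (hB : ∀ u w, inner ℝ (B u) w = inner ℝ u (B w)) (hδ : 0 < δ)
    (hvt : ‖v‖ ^ 2 + t ^ 2 ≤ 1)
    (hmin : ∀ a b, ‖a‖ ^ 2 + b ^ 2 ≤ 1 → homModel T B g δ v t ≤ homModel T B g δ a b) :
    ∃ θ, δ ≤ θ ∧ θ = -homModel T B g δ v t ∧ ‖v‖ ^ 2 + t ^ 2 = 1 ∧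
      (∀ a b, 0 ≤ homModel T B g δ a b + θ * (‖a‖ ^ 2 + b ^ 2)) ∧
      (∀ a, inner ℝ (B (T v)) (T a) + t * inner ℝ g (T a) + θ * inner ℝ v a = 0) ∧
      inner ℝ g (T v) = (δ - θ) * t := by
  -- The multiplier is minus the optimal value; the feasible point `[0; 1]` has value `-δ`.
  have hθ : δ ≤ -homModel T B g δ v t := by
    have := hmin 0 1 (by simp)
    simp only [homModel, map_zero, inner_zero_right] at this ⊢
    linarith
  obtain ⟨θ, hθd⟩ : ∃ θ, θ = -homModel T B g δ v t := ⟨_, rfl⟩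
  rw [← hθd] at hθ
  -- The model is homogeneous of degree 2, so its minimum on the unit ball bounds its Rayleigh
  -- quotient everywhere.
  have hpsd : ∀ a b, 0 ≤ homModel T B g δ a b + θ * (‖a‖ ^ 2 + b ^ 2) := by
    intro a b
    rcases eq_or_lt_of_le (show 0 ≤ ‖a‖ ^ 2 + b ^ 2 by positivity) with h | h
    · have ha : a = 0 := by
        have : ‖a‖ ^ 2 = 0 := by nlinarith [sq_nonneg b, sq_nonneg ‖a‖]
        simpa using this
      have hb : b = 0 := by
        have : b ^ 2 = 0 := by nlinarith [sq_nonneg b, sq_nonneg ‖a‖]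
        simpa using this
      simp [ha, hb, homModel]
    · set N := ‖a‖ ^ 2 + b ^ 2 with hN
      have hs : 0 < √N := Real.sqrt_pos.2 h
      have hsq : (√N)⁻¹ ^ 2 = N⁻¹ := by rw [inv_pow, Real.sq_sqrt h.le]
      have h1 := hmin ((√N)⁻¹ • a) ((√N)⁻¹ * b) (by
        rw [norm_smul, mul_pow, mul_pow, Real.norm_eq_abs, sq_abs, ← mul_add, hsq, ← hN,
          inv_mul_cancel₀ h.ne'])
      rw [homModel_smul, hsq] at h1
      have h2 : -θ * N ≤ homModel T B g δ a b := by
        have := mul_le_mul_of_nonneg_right h1 h.le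
        rwa [mul_right_comm, inv_mul_cancel₀ h.ne', one_mul,
          show homModel T B g δ v t = -θ by linarith] at this
      linarith
  have hone : ‖v‖ ^ 2 + t ^ 2 = 1 := by
    have := hpsd v t
    nlinarith
  have hcrit : ∀ a b, inner ℝ (B (T v)) (T a) + t * inner ℝ g (T a) + b * inner ℝ g (T v)
      - δ * t * b + θ * (inner ℝ v a + t * b) = 0 := by
    intro a b
    have := eq_zero_of_forall_linear_add_quadratic_nonneg
      (p := 2 * (inner ℝ (B (T v)) (T a) + t * inner ℝ g (T a) + b * inner ℝ g (T v) - δ * t * b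
        + θ * (inner ℝ v a + t * b)))
      (r := homModel T B g δ a b + θ * (‖a‖ ^ 2 + b ^ 2)) (fun τ => by
        have h1 := hpsd (v + τ • a) (t + τ * b)
        rw [homModel_add g δ θ hB, hone, hθd] at h1
        rw [hθd]
        linarith)
    linarith
  refine ⟨θ, hθ, hθd, hone, hpsd, fun a => ?_, ?_⟩
  · have := hcrit a 0
    linarith
  · have := hcrit 0 1
    simp only [map_zero, inner_zero_right] at this
    linarith

/-- The search direction `T v / t`, or `T v` when `t = 0`. -/
noncomputable def homDirection (T : V →ₗ[ℝ] F) (v : V) (t : ℝ) : F :=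
  if t ≠ 0 then t⁻¹ • T v else T v

/-- For `d = T w` and a step `η d` with `0 ≤ η ≤ 1`, the model value is `(η - η²/2) ⟨g, d⟩ - η² θ
‖w‖² / 2`. The first term is nonpositive, and `θ ‖w‖² ≥ R² σ ‖w‖² ≥ σ ‖d‖²`. -/
theorem model_decrease {T : V →ₗ[ℝ] F} {B : F →L[ℝ] F} {g : F} {δ σ R Δ : ℝ} {v : V} {t : ℝ}
    (hB : ∀ u w, inner ℝ (B u) w = inner ℝ u (B w)) (hδ : 0 < δ)
    (hvt : ‖v‖ ^ 2 + t ^ 2 ≤ 1)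
    (hmin : ∀ a b, ‖a‖ ^ 2 + b ^ 2 ≤ 1 → homModel T B g δ v t ≤ homModel T B g δ a b)
    (hT : ∀ a, ‖T a‖ ≤ R * ‖a‖) (hδσ : δ = R ^ 2 * σ) (hσ : 0 ≤ σ) (hΔ : 0 ≤ Δ)
    (hd : Δ < ‖homDirection T v t‖) :
    inner ℝ g ((Δ / ‖homDirection T v t‖) • homDirection T v t) +
      inner ℝ (B ((Δ / ‖homDirection T v t‖) • homDirection T v t))
        ((Δ / ‖homDirection T v t‖) • homDirection T v t) / 2 ≤ -(σ * Δ ^ 2) / 2 := by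
  obtain ⟨θ, hδθ, -, -, -, hcrit, hgv⟩ := exists_multiplier hB hδ hvt hmin
  -- A form common to `t = 0` (`w = v`) and `t ≠ 0` (`w = v / t`). When `t = 0` the optimality
  -- conditions force `⟨g, T v⟩ = 0`.
  obtain ⟨w, hw, hgd, hBd⟩ : ∃ w, homDirection T v t = T w ∧ inner ℝ g (T w) ≤ 0 ∧
      inner ℝ (B (T w)) (T w) + inner ℝ g (T w) + θ * ‖w‖ ^ 2 = 0 := by
    by_cases ht : t = 0
    · refine ⟨v, by simp [homDirection, ht], by rw [hgv, ht]; simp, ?_⟩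
      have := hcrit v
      rw [ht] at hgv this
      rw [hgv, ← real_inner_self_eq_norm_sq]
      linarith
    · have h1 : inner ℝ g (T (t⁻¹ • v)) = δ - θ := by
        rw [map_smul, inner_smul_right, hgv]
        field_simp
      refine ⟨t⁻¹ • v, by simp [homDirection, ht], by rw [h1]; linarith, ?_⟩
      have h2 := hcrit v
      rw [hgv] at h2
      rw [h1, map_smul, map_smul, inner_smul_left, inner_smul_right, norm_smul, mul_pow,
        ← real_inner_self_eq_norm_sq v, Real.norm_eq_abs, sq_abs, RCLike.conj_to_real]
      have h3 : inner ℝ (B (T v)) (T v) = -(t * ((δ - θ) * t)) - θ * inner ℝ v v := by linarith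
      rw [h3]
      field_simp
      ring
  rw [hw] at hd ⊢
  have hpos : 0 < ‖T w‖ := hΔ.trans_lt hd
  set η := Δ / ‖T w‖ with hη
  have hη0 : 0 ≤ η := by positivity
  have hη1 : η ≤ 1 := by rw [hη, div_le_one hpos]; exact hd.le
  have hηd : η * ‖T w‖ = Δ := by rw [hη]; field_simp
  have hθw : σ * ‖T w‖ ^ 2 ≤ θ * ‖w‖ ^ 2 := by
    have h1 : ‖T w‖ ^ 2 ≤ R ^ 2 * ‖w‖ ^ 2 := by
      rw [← mul_pow]; exact pow_le_pow_left₀ hpos.le (hT w) 2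
    calc σ * ‖T w‖ ^ 2 ≤ σ * (R ^ 2 * ‖w‖ ^ 2) := by gcongr
      _ = δ * ‖w‖ ^ 2 := by rw [hδσ]; ring
      _ ≤ θ * ‖w‖ ^ 2 := by gcongr
  rw [map_smul, inner_smul_right, inner_smul_left, inner_smul_right, RCLike.conj_to_real]
  have h4 : inner ℝ (B (T w)) (T w) = -inner ℝ g (T w) - θ * ‖w‖ ^ 2 := by linarith
  rw [h4]
  have h5 : (η - η ^ 2 / 2) * inner ℝ g (T w) ≤ 0 :=
    mul_nonpos_of_nonneg_of_nonpos (by nlinarith) hgd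
  have h6 : σ * Δ ^ 2 ≤ η ^ 2 * (θ * ‖w‖ ^ 2) := by
    calc σ * Δ ^ 2 = η ^ 2 * (σ * ‖T w‖ ^ 2) := by rw [← hηd]; ring
      _ ≤ _ := by gcongr
  nlinarith

theorem norm_adjoint_apply_le {T : V →ₗ[ℝ] F} {S : F →ₗ[ℝ] V} {R : ℝ} (hR : 0 ≤ R)
    (hS : ∀ u a, inner ℝ (S u) a = inner ℝ u (T a)) (hT : ∀ a, ‖T a‖ ≤ R * ‖a‖) (u : F) :
    ‖S u‖ ≤ R * ‖u‖ := by
  rcases eq_or_lt_of_le (norm_nonneg (S u)) with h | h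
  · rw [← h]
    positivity
  · have h1 : ‖S u‖ ^ 2 ≤ ‖u‖ * (R * ‖S u‖) := by
      rw [← real_inner_self_eq_norm_sq, hS]
      exact (real_inner_le_norm _ _).trans (by gcongr; exact hT _)
    nlinarith

theorem inner_le_of_norm_apply_le {B : F →L[ℝ] F} {L : ℝ} (hBL : ∀ u, ‖B u‖ ≤ L * ‖u‖) (u : F) :
    |inner ℝ (B u) u| ≤ L * ‖u‖ ^ 2 := by
  calc |inner ℝ (B u) u| ≤ ‖B u‖ * ‖u‖ := abs_real_inner_le_norm _ _
    _ ≤ L * ‖u‖ * ‖u‖ := by gcongr; exact hBL u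
    _ = _ := by ring

/-- For `t ≠ 0`, applying `T` to `S g = -S (B d) - θ w` gives `‖T (S g)‖ ≤ (L R² + θ) Δ`. Since `θ ≤
L R² + ‖S g‖ + δ`, the resulting term `Δ ‖S g‖` is absorbed into `β ‖S g‖`. For `t = 0`, `θ ≤ L Δ²`
and semidefiniteness bounds `‖S g‖`. -/
theorem sketched_gradient_le {T : V →ₗ[ℝ] F} {S : F →ₗ[ℝ] V} {B : F →L[ℝ] F} {g : F}
    {δ L R Δ β : ℝ} {v : V} {t : ℝ}
    (hB : ∀ u w, inner ℝ (B u) w = inner ℝ u (B w)) (hδ : 0 < δ)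
    (hvt : ‖v‖ ^ 2 + t ^ 2 ≤ 1)
    (hmin : ∀ a b, ‖a‖ ^ 2 + b ^ 2 ≤ 1 → homModel T B g δ v t ≤ homModel T B g δ a b)
    (hS : ∀ u a, inner ℝ (S u) a = inner ℝ u (T a)) (hT : ∀ a, ‖T a‖ ≤ R * ‖a‖)
    (hL : 0 ≤ L) (hBL : ∀ u, ‖B u‖ ≤ L * ‖u‖) (hR : 1 ≤ R) (hΔ : 0 ≤ Δ) (hΔβ : Δ ≤ β)
    (hβ : β ≤ 1) (hTS : β * ‖S g‖ ≤ ‖T (S g)‖) (hd : ‖homDirection T v t‖ ≤ Δ) :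
    (β - Δ) * ‖S g‖ ≤ (2 * L * R ^ 2 + δ) * Δ := by
  obtain ⟨θ, hδθ, hθ, hone, hpsd, hcrit, hgv⟩ := exists_multiplier hB hδ hvt hmin
  have hθ0 : 0 < θ := hδ.trans_le hδθ
  have hBT : ∀ a, |inner ℝ (B (T a)) (T a)| ≤ L * R ^ 2 * ‖a‖ ^ 2 := fun a => by
    refine (inner_le_of_norm_apply_le hBL _).trans ?_
    calc L * ‖T a‖ ^ 2 ≤ L * (R * ‖a‖) ^ 2 := by gcongr; exact hT a
      _ = _ := by ring
  by_cases ht : t = 0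
  · have hdir : homDirection T v t = T v := by simp [homDirection, ht]
    rw [hdir] at hd
    have hv : ‖v‖ ^ 2 = 1 := by rw [ht] at hone; linarith
    have hθL : θ ≤ L * Δ ^ 2 := by
      have h1 := hcrit v
      rw [ht, real_inner_self_eq_norm_sq, hv] at h1
      have h2 := neg_abs_le (inner ℝ (B (T v)) (T v))
      have h3 := inner_le_of_norm_apply_le hBL (T v)
      have h4 : L * ‖T v‖ ^ 2 ≤ L * Δ ^ 2 := by gcongr
      linarith
    set p := ‖S g‖ with hp
    have hp0 : 0 ≤ p := norm_nonneg _
    have hK : 0 < L * R ^ 2 + θ := by positivity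
    -- Test semidefiniteness at `[a; 1]` with `a = -K⁻¹ S g`, `K = L R² + θ`, the minimizer of the
    -- upper bound `K ‖a‖² + 2 ⟨S g, a⟩ + θ`.
    have hp2 : p ^ 2 ≤ (L * R ^ 2 + θ) * θ := by
      have h1 := hpsd ((-(L * R ^ 2 + θ)⁻¹) • S g) 1
      have h2 := (le_abs_self _).trans (hBT ((-(L * R ^ 2 + θ)⁻¹) • S g))
      rw [norm_smul, mul_pow, ← hp, Real.norm_eq_abs, sq_abs] at h1 h2
      have h3 : inner ℝ g (T ((-(L * R ^ 2 + θ)⁻¹) • S g)) = -(L * R ^ 2 + θ)⁻¹ * p ^ 2 := by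
        rw [map_smul, inner_smul_right, ← hS, real_inner_self_eq_norm_sq]
      rw [homModel, h3] at h1
      have h4 : 0 ≤ (L * R ^ 2 + θ) * ((-(L * R ^ 2 + θ)⁻¹) ^ 2 * p ^ 2)
          + 2 * (-(L * R ^ 2 + θ)⁻¹ * p ^ 2) + θ := by
        linarith
      have h5 : (L * R ^ 2 + θ) * ((-(L * R ^ 2 + θ)⁻¹) ^ 2 * p ^ 2)
          + 2 * (-(L * R ^ 2 + θ)⁻¹ * p ^ 2) + θ
          = ((L * R ^ 2 + θ) * θ - p ^ 2) / (L * R ^ 2 + θ) := by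
        field_simp
        ring
      rw [h5] at h4
      have := (div_nonneg_iff.1 h4).resolve_right (fun h => absurd h.2 (not_le.2 hK))
      linarith [this.1]
    have hΔR : Δ ≤ R := (hΔβ.trans hβ).trans hR
    have hp3 : p ≤ 2 * L * R ^ 2 * Δ := by
      have hLL : (L * R ^ 2 + θ) * θ ≤ (2 * L * R ^ 2 * Δ) ^ 2 := by
        have h1 : L * Δ ^ 2 ≤ L * R ^ 2 := by gcongr
        calc (L * R ^ 2 + θ) * θ ≤ (L * R ^ 2 + L * R ^ 2) * (L * Δ ^ 2) := by
              gcongr; exact hθL.trans h1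
          _ = 2 * L ^ 2 * (R ^ 2 * 1) * Δ ^ 2 := by ring
          _ ≤ 4 * L ^ 2 * (R ^ 2 * R ^ 2) * Δ ^ 2 := by
              gcongr
              · norm_num
              · exact one_le_pow₀ hR
          _ = _ := by ring
      exact le_of_sq_le_sq (hp2.trans hLL) (by positivity)
    have : (β - Δ) * p ≤ 1 * p := by gcongr; linarith
    nlinarith
  · set w := t⁻¹ • v with hw
    have hdir : homDirection T v t = T w := by simp [homDirection, ht, hw]
    rw [hdir] at hd
    have hkey : S g = -S (B (T w)) - θ • w := by
      refine ext_inner_right ℝ fun a => ?_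
      rw [inner_sub_left, inner_neg_left, inner_smul_left, hS, hS, hw, map_smul, map_smul,
        inner_smul_left, inner_smul_left]
      simp only [RCLike.conj_to_real]
      have := hcrit a
      field_simp
      linarith
    have hθp : θ ≤ L * R ^ 2 + ‖S g‖ + δ := by
      rw [hθ, homModel]
      have h1 := neg_abs_le (inner ℝ (B (T v)) (T v))
      have h2 := hBT v
      have h3 : |2 * t * inner ℝ g (T v)| ≤ ‖S g‖ := by
        rw [← hS, abs_mul]
        have h4 := abs_real_inner_le_norm (S g) v
        have h5 : |2 * t| * ‖v‖ ≤ 1 := by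
          rw [abs_mul, abs_two]
          nlinarith [sq_nonneg (|t| - ‖v‖), sq_abs t]
        calc |2 * t| * |inner ℝ (S g) v| ≤ |2 * t| * (‖S g‖ * ‖v‖) := by gcongr
          _ = |2 * t| * ‖v‖ * ‖S g‖ := by ring
          _ ≤ 1 * ‖S g‖ := by gcongr
          _ = _ := one_mul _
      have h6 := neg_abs_le (2 * t * inner ℝ g (T v))
      have h7 : L * R ^ 2 * ‖v‖ ^ 2 ≤ L * R ^ 2 * 1 := by gcongr; nlinarith [sq_nonneg t]
      have h8 : δ * t ^ 2 ≤ δ * 1 := by gcongr; nlinarith [sq_nonneg ‖v‖]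
      linarith
    have hnorm : ‖T (S g)‖ ≤ R ^ 2 * L * Δ + θ * Δ := by
      have h1 : T (S g) = -T (S (B (T w))) - θ • T w := by
        conv_lhs => rw [hkey]
        rw [map_sub, map_neg, map_smul T θ w]
      rw [h1]
      refine (norm_sub_le _ _).trans ?_
      rw [norm_neg, norm_smul, Real.norm_eq_abs, abs_of_pos hθ0]
      have hR0 : 0 ≤ R := by linarith
      have h2 : ‖T (S (B (T w)))‖ ≤ R * (R * (L * Δ)) := by
        refine (hT _).trans ?_
        gcongr
        refine (norm_adjoint_apply_le hR0 hS hT _).trans ?_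
        gcongr
        exact (hBL _).trans (by gcongr)
      have h3 : θ * ‖T w‖ ≤ θ * Δ := by gcongr
      linarith
    have h9 : θ * Δ ≤ (L * R ^ 2 + ‖S g‖ + δ) * Δ := by gcongr
    linarith

theorem differentiable_gradient [CompleteSpace F] {f : F → ℝ} (hf : ContDiff ℝ 2 f) :
    Differentiable ℝ (gradient f) := by
  have : ContDiff ℝ 1 (fun z => (InnerProductSpace.toDual ℝ F).symm (fderiv ℝ f z)) :=
    (InnerProductSpace.toDual ℝ F).symm.contDiff.comp (hf.fderiv_right (m := 1) (by norm_num))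
  exact this.differentiable (by norm_num)

/-- The cubic upper bound for a function with Lipschitz Hessian. -/
theorem le_cubic_model [CompleteSpace F] {f : F → ℝ} {M : ℝ≥0} (hf : ContDiff ℝ 2 f)
    (hM : LipschitzWith M (fderiv ℝ (gradient f))) (x h : F) :
    f (x + h) ≤ f x + inner ℝ (gradient f x) h
      + inner ℝ (fderiv ℝ (gradient f) x h) h / 2 + M / 6 * ‖h‖ ^ 3 := by
  have hfd : ∀ z, HasGradientAt f (gradient f z) z := fun z =>
    ((hf.differentiable (by norm_num)) z).hasGradientAt
  have hgd := differentiable_gradient hf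
  have hline : ∀ t : ℝ, HasDerivAt (fun t : ℝ => x + t • h) h t := fun t => by
    simpa using ((hasDerivAt_id t).smul_const h).const_add x
  have hφ : ∀ t : ℝ, HasDerivAt (fun t : ℝ => f (x + t • h))
      (inner ℝ (gradient f (x + t • h)) h) t := fun t => by
    refine ((hfd (x + t • h)).hasFDerivAt.comp_hasDerivAt t (hline t)).congr_deriv ?_
    simp
  have hφ' : ∀ t : ℝ, HasDerivAt (fun t : ℝ => inner ℝ (gradient f (x + t • h)) h)
      (inner ℝ (fderiv ℝ (gradient f) (x + t • h) h) h) t := fun t => by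
    have := ((hgd (x + t • h)).hasFDerivAt.comp_hasDerivAt t (hline t)).inner ℝ
      (hasDerivAt_const t h)
    simpa using this
  have hB : ∀ t : ℝ, 0 ≤ t → inner ℝ (fderiv ℝ (gradient f) (x + t • h) h) h ≤
      inner ℝ (fderiv ℝ (gradient f) x h) h + M * t * ‖h‖ ^ 3 := fun t ht => by
    have h1 : ‖fderiv ℝ (gradient f) (x + t • h) - fderiv ℝ (gradient f) x‖ ≤ M * (t * ‖h‖) := by
      have := hM.dist_le_mul (x + t • h) x
      rwa [dist_eq_norm, dist_eq_norm, add_sub_cancel_left, norm_smul, Real.norm_eq_abs,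
        abs_of_nonneg ht] at this
    have h2 : inner ℝ ((fderiv ℝ (gradient f) (x + t • h) - fderiv ℝ (gradient f) x) h) h
        ≤ M * (t * ‖h‖) * ‖h‖ * ‖h‖ :=
      (real_inner_le_norm _ _).trans (by
        gcongr
        exact (ContinuousLinearMap.le_opNorm _ _).trans (by gcongr))
    rw [sub_apply, inner_sub_left] at h2
    linarith
  -- Monotonicity replaces integration of the remainder; it is used twice, first for the derivative
  -- along the segment, then for `f` itself.
  have hmono : ∀ {ψ ψ' : ℝ → ℝ}, (∀ t, HasDerivAt ψ (ψ' t) t) → (∀ t, 0 ≤ t → 0 ≤ ψ' t) →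
      ∀ t, 0 ≤ t → ψ 0 ≤ ψ t := fun {ψ ψ'} h1 h2 t ht =>
    (monotoneOn_of_deriv_nonneg (convex_Ici (0 : ℝ))
      (fun t _ => (h1 t).continuousAt.continuousWithinAt)
      (fun t _ => (h1 t).differentiableAt.differentiableWithinAt)
      (fun t ht => by
        rw [interior_Ici, Set.mem_Ioi] at ht
        rw [(h1 t).deriv]
        exact h2 t ht.le)) Set.self_mem_Ici ht ht
  set a := inner ℝ (gradient f x) h with ha
  set b := inner ℝ (fderiv ℝ (gradient f) x h) h with hb
  have hpow : ∀ (n : ℕ) (t : ℝ), HasDerivAt (fun t : ℝ => t ^ n) (n * t ^ (n - 1)) t :=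
    fun n t => hasDerivAt_pow n t
  have hfirst : ∀ t : ℝ, 0 ≤ t →
      0 ≤ a + t * b + M / 2 * ‖h‖ ^ 3 * t ^ 2 - inner ℝ (gradient f (x + t • h)) h := by
    intro t ht
    have := hmono
      (ψ := fun t => a + t * b + M / 2 * ‖h‖ ^ 3 * t ^ 2 - inner ℝ (gradient f (x + t • h)) h)
      (ψ' := fun t => b + M / 2 * ‖h‖ ^ 3 * (2 * t)
        - inner ℝ (fderiv ℝ (gradient f) (x + t • h) h) h)
      (fun t => by
        refine (((((hasDerivAt_id t).mul_const b).const_add a).add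
          ((hpow 2 t).const_mul (M / 2 * ‖h‖ ^ 3))).sub (hφ' t)).congr_deriv ?_
        simp)
      (fun t ht => by
        have := hB t ht
        nlinarith) t ht
    simpa [ha] using this
  have := hmono
    (ψ := fun t => f x + t * a + t ^ 2 * (b / 2) + M / 6 * ‖h‖ ^ 3 * t ^ 3 - f (x + t • h))
    (ψ' := fun t => a + t * b + M / 2 * ‖h‖ ^ 3 * t ^ 2 - inner ℝ (gradient f (x + t • h)) h)
    (fun t => by
      refine ((((((hasDerivAt_id t).mul_const a).const_add (f x)).add
        ((hpow 2 t).mul_const (b / 2))).add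
          ((hpow 3 t).const_mul (M / 6 * ‖h‖ ^ 3))).sub (hφ t)).congr_deriv ?_
      simp
      ring) hfirst 1 zero_le_one
  simp at this
  linarith

end Deterministic

/-! ### Chi-square moment generating functions and rotation invariance of Gaussian vectors. -/

section GaussianVectors

theorem integral_exp_mul_sq_gaussianReal {v : ℝ≥0} (hv : v ≠ 0) {a : ℝ} (ha : 2 * a * v < 1) :
    ∫ x, Real.exp (a * x ^ 2) ∂gaussianReal 0 v = (√(1 - 2 * a * v))⁻¹ := by
  have hv0 : (0 : ℝ) < v := by positivity
  have h1 : 0 < 1 - 2 * a * v := by linarith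
  rw [integral_gaussianReal_eq_integral_smul hv]
  have h2 : ∀ x : ℝ, gaussianPDFReal 0 v x • Real.exp (a * x ^ 2) =
      (√(2 * Real.pi * v))⁻¹ * Real.exp (-((1 - 2 * a * v) / (2 * v)) * x ^ 2) := fun x => by
    rw [gaussianPDFReal, smul_eq_mul, mul_assoc, ← Real.exp_add]
    congr 2
    field_simp
    ring
  simp_rw [h2]
  rw [integral_const_mul, integral_gaussian, ← Real.sqrt_inv, ← Real.sqrt_inv,
    ← Real.sqrt_mul (by positivity)]
  congr 1
  field_simp

variable {ι κ : Type*} [Fintype ι] [Fintype κ]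

/-- The law of a vector with independent centred Gaussian entries of variance `v`. -/
noncomputable abbrev gaussianVector (ι : Type*) [Fintype ι] (v : ℝ≥0) : Measure (ι → ℝ) :=
  Measure.pi fun _ : ι => gaussianReal 0 v

theorem mgf_sum_sq_gaussianVector {v : ℝ≥0} (hv : v ≠ 0) {a : ℝ} (ha : 2 * a * v < 1) :
    mgf (fun x : ι → ℝ => ∑ i, x i ^ 2) (gaussianVector ι v) a
      = (√(1 - 2 * a * v))⁻¹ ^ Fintype.card ι := by
  simp_rw [mgf, Finset.mul_sum, Real.exp_sum]
  rw [integral_fintype_prod_eq_pow (fun x : ℝ => Real.exp (a * x ^ 2)),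
    integral_exp_mul_sq_gaussianReal hv ha]

theorem integrable_exp_sum_sq_gaussianVector {v : ℝ≥0} (hv : v ≠ 0) {a : ℝ} (ha : 2 * a * v < 1) :
    Integrable (fun x : ι → ℝ => Real.exp (a * ∑ i, x i ^ 2)) (gaussianVector ι v) := by
  have h1 : 0 < 1 - 2 * a * v := by linarith
  have := mgf_sum_sq_gaussianVector (ι := ι) hv ha
  -- A non-integrable function has integral `0` by convention, so a positive value forces
  -- integrability.
  exact .of_integral_ne_zero (by rw [mgf] at this; rw [this]; positivity)

theorem gaussianVector_sum_sq_ge_le {v : ℝ≥0} (hv : v ≠ 0) {a : ℝ} (ha0 : 0 ≤ a)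
    (ha : 2 * a * v < 1) (r : ℝ) :
    (gaussianVector ι v).real {x | r ≤ ∑ i, x i ^ 2} ≤
      Real.exp (-a * r) * (√(1 - 2 * a * v))⁻¹ ^ Fintype.card ι := by
  rw [← mgf_sum_sq_gaussianVector hv ha]
  exact measure_ge_le_exp_mul_mgf r ha0 (integrable_exp_sum_sq_gaussianVector hv ha)

theorem gaussianVector_sum_sq_le_le {v : ℝ≥0} (hv : v ≠ 0) {a : ℝ} (ha0 : a ≤ 0) (r : ℝ) :
    (gaussianVector ι v).real {x | ∑ i, x i ^ 2 ≤ r} ≤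
      Real.exp (-a * r) * (√(1 - 2 * a * v))⁻¹ ^ Fintype.card ι := by
  have ha : 2 * a * v < 1 := by nlinarith [v.2, NNReal.coe_nonneg v]
  rw [← mgf_sum_sq_gaussianVector hv ha]
  exact measure_le_le_exp_mul_mgf r ha0 (integrable_exp_sum_sq_gaussianVector hv ha)

theorem gaussianVector_map_toLp (v : ℝ≥0) :
    (gaussianVector ι v).map (WithLp.toLp 2) =
      (stdGaussian (EuclideanSpace ℝ ι)).map (fun w => √v • w) := by
  have h1 : gaussianReal 0 v = (gaussianReal 0 1).map (√v * ·) := by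
    rw [gaussianReal_map_const_mul]
    congr 1
    · simp
    · ext
      simp
  rw [gaussianVector, h1, ← Measure.pi_map_pi (fun _ => by fun_prop), ← map_pi_eq_stdGaussian,
    Measure.map_map (by fun_prop) (by fun_prop), Measure.map_map (by fun_prop) (by fun_prop)]
  rfl

/-- Gaussian vectors with independent entries of equal variance are rotation invariant. -/
theorem gaussianVector_map_isometry (v : ℝ≥0)
    (U : EuclideanSpace ℝ ι ≃ₗᵢ[ℝ] EuclideanSpace ℝ ι) :
    (gaussianVector ι v).map (fun w => (U (WithLp.toLp 2 w)).ofLp) = gaussianVector ι v := by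
  have h1 : ((gaussianVector ι v).map (WithLp.toLp 2)).map U
      = (gaussianVector ι v).map (WithLp.toLp 2) := by
    rw [gaussianVector_map_toLp, Measure.map_map (by fun_prop) (by fun_prop)]
    conv_rhs => rw [← stdGaussian_map U, Measure.map_map (by fun_prop) (by fun_prop)]
    congr 1
    ext1 w
    simp
  have h2 : (fun w : ι → ℝ => (U (WithLp.toLp 2 w)).ofLp)
      = WithLp.ofLp ∘ (U ∘ WithLp.toLp 2) := rfl
  rw [h2, ← Measure.map_map (by fun_prop) (by fun_prop),
    ← Measure.map_map (by fun_prop) (by fun_prop), h1,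
    Measure.map_map (by fun_prop) (by fun_prop)]
  exact Measure.map_id

/-- The reflection in the hyperplane orthogonal to `x - y` exchanges two vectors of equal norm. -/
theorem exists_isometry_apply_eq {H : Type*} [NormedAddCommGroup H] [InnerProductSpace ℝ H]
    [CompleteSpace H] {x y : H} (h : ‖x‖ = ‖y‖) : ∃ U : H ≃ₗᵢ[ℝ] H, U x = y :=
  ⟨(ℝ ∙ (x - y))ᗮ.reflection, Submodule.reflection_sub h⟩

/-- An isometry taking `g` to a coordinate vector turns the projection onto `g` into a coordinate.
-/
theorem gaussianVector_map_dotProduct [DecidableEq ι] [Nonempty ι] (v : ℝ≥0) {g : ι → ℝ}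
    (hg : g ⬝ᵥ g = 1) :
    (gaussianVector ι v).map (fun w => w ⬝ᵥ g) = gaussianReal 0 v := by
  obtain ⟨i⟩ := ‹Nonempty ι›
  have hn : ‖(WithLp.toLp 2 g : EuclideanSpace ℝ ι)‖ = ‖EuclideanSpace.single i (1 : ℝ)‖ := by
    rw [EuclideanSpace.norm_eq]
    simp only [dotProduct] at hg
    simp [pow_two, hg]
  obtain ⟨U, hU⟩ := exists_isometry_apply_eq hn
  have h1 : (fun w : ι → ℝ => w ⬝ᵥ g) =
      Function.eval i ∘ fun w => (U (WithLp.toLp 2 w)).ofLp := by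
    ext w
    have h2 : inner ℝ (U (WithLp.toLp 2 g)) (U (WithLp.toLp 2 w)) = w ⬝ᵥ g := by
      rw [U.inner_map_map]
      simp [EuclideanSpace.inner_eq_star_dotProduct]
    rw [hU] at h2
    rw [EuclideanSpace.inner_single_left] at h2
    simpa using h2.symm
  rw [h1, ← Measure.map_map (by fun_prop) (by fun_prop), gaussianVector_map_isometry,
    Measure.pi_map_eval]
  simp

end GaussianVectors

/-! ### Gaussian matrices: transposition, rotation of rows, action on a unit vector. -/

section GaussianMatrices

variable {ι κ : Type*} [Fintype ι] [Fintype κ]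

/-- The law of a family of independent Gaussian rows. -/
noncomputable abbrev gaussianRows (ι κ : Type*) [Fintype ι] [Fintype κ] (v : ℝ≥0) :
    Measure (ι → κ → ℝ) :=
  Measure.pi fun _ : ι => gaussianVector κ v

theorem gaussianRows_eq_map_curry (v : ℝ≥0) :
    gaussianRows ι κ v = (gaussianVector (ι × κ) v).map (MeasurableEquiv.curry ι κ ℝ) := by
  rw [gaussianVector, ← Measure.infinitePi_eq_pi,
    Measure.infinitePi_map_curry (fun (_ : ι) (_ : κ) => gaussianReal 0 v)]
  simp [Measure.infinitePi_eq_pi]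

theorem gaussianVector_map_comp_equiv (v : ℝ≥0) (e : κ ≃ ι) :
    (gaussianVector ι v).map (fun w k => w (e k)) = gaussianVector κ v := by
  refine (Measure.pi_eq fun s hs => ?_).symm
  rw [Measure.map_apply (by fun_prop) (MeasurableSet.univ_pi hs)]
  have : (fun (w : ι → ℝ) k => w (e k)) ⁻¹' Set.univ.pi s
      = Set.univ.pi fun i => s (e.symm i) := by
    ext w
    simp only [Set.mem_preimage, Set.mem_pi, Set.mem_univ, true_implies]
    exact ⟨fun h i => by simpa using h (e.symm i), fun h k => by simpa using h (e k)⟩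
  rw [this, Measure.pi_pi]
  exact Fintype.prod_equiv e.symm _ _ fun _ => rfl

/-- Carries results about `P g` over to `Pᵀ u`: independent identically distributed entries do not
see which index is the row. -/
theorem gaussianRows_map_swap (v : ℝ≥0) :
    (gaussianRows ι κ v).map Function.swap = gaussianRows κ ι v := by
  have hsw : Measurable (Function.swap : (ι → κ → ℝ) → κ → ι → ℝ) := by
    unfold Function.swap; fun_prop
  rw [gaussianRows_eq_map_curry, gaussianRows_eq_map_curry,
    ← gaussianVector_map_comp_equiv v (Equiv.prodComm κ ι), Measure.map_map hsw (by fun_prop),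
    Measure.map_map (by fun_prop) (by fun_prop)]
  rfl

theorem gaussianRows_map_isometry (v : ℝ≥0)
    (U : EuclideanSpace ℝ κ ≃ₗᵢ[ℝ] EuclideanSpace ℝ κ) :
    (gaussianRows ι κ v).map (fun P i => (U (WithLp.toLp 2 (P i))).ofLp) = gaussianRows ι κ v := by
  have h := gaussianVector_map_isometry v U
  have : SigmaFinite ((gaussianVector κ v).map fun w => (U (WithLp.toLp 2 w)).ofLp) := by
    rw [h]; infer_instance
  refine (Measure.pi_map_pi (f := fun (_ : ι) (w : κ → ℝ) => (U (WithLp.toLp 2 w)).ofLp)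
    (fun _ => by fun_prop)).trans ?_
  simp_rw [h]

theorem gaussianRows_map_mulVec [DecidableEq κ] [Nonempty κ] (v : ℝ≥0) {g : κ → ℝ}
    (hg : g ⬝ᵥ g = 1) :
    (gaussianRows ι κ v).map (fun P i => P i ⬝ᵥ g) = gaussianVector ι v := by
  have h := gaussianVector_map_dotProduct v hg
  have : SigmaFinite ((gaussianVector κ v).map fun w => w ⬝ᵥ g) := by
    rw [h]; infer_instance
  have hm : Measurable fun w : κ → ℝ => w ⬝ᵥ g := by
    unfold dotProduct; fun_prop
  refine (Measure.pi_map_pi (f := fun (_ : ι) (w : κ → ℝ) => w ⬝ᵥ g)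
    (fun _ => hm.aemeasurable)).trans ?_
  simp_rw [h]

end GaussianMatrices

/-! ### Tail bounds for `P g`, `Pᵀ u` and `Pᵀ P g`. -/

section Tails

variable {ι κ : Type*} [Fintype ι] [Fintype κ]

theorem gaussianRows_mulVec_sq_le_le [DecidableEq κ] [Nonempty κ] [Nonempty ι] {g : κ → ℝ}
    (hg : g ⬝ᵥ g = 1) :
    (gaussianRows ι κ (Fintype.card ι : ℝ≥0)⁻¹).real {P | ∑ i, (P i ⬝ᵥ g) ^ 2 ≤ 1 / 100} ≤
      Real.exp (2 / 5 * Fintype.card ι) * (9⁻¹) ^ Fintype.card ι := by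
  have hv : (Fintype.card ι : ℝ≥0)⁻¹ ≠ 0 := by simp
  have hs : (0 : ℝ) < Fintype.card ι := by exact_mod_cast Fintype.card_pos
  -- With variance `1/s` and `a = -40 s`, `1 - 2 a v = 81`, whence the factor `9⁻¹` per coordinate.
  have h1 := gaussianVector_sum_sq_le_le (ι := ι) hv
    (a := -(40 * Fintype.card ι)) (by linarith) (1 / 100)
  rw [← gaussianRows_map_mulVec (κ := κ) _ hg, map_measureReal_apply
    (by unfold dotProduct; fun_prop) (measurableSet_le (by fun_prop) (by fun_prop))] at h1
  refine h1.trans (le_of_eq ?_)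
  congr 1
  · congr 1; ring
  · congr 2
    push_cast
    rw [show 1 - 2 * -(40 * (Fintype.card ι : ℝ)) * (Fintype.card ι : ℝ)⁻¹ = 9 ^ 2 by
      field_simp; norm_num]
    exact Real.sqrt_sq (by norm_num)

/-- Half of the first-order Taylor estimate for `log (1 - 2 μ)`. Cancelling the linear term against
the mean leaves a quadratic exponent. -/
theorem inv_sqrt_one_sub_le {μ : ℝ} (hμ : |μ| ≤ 1 / 4) :
    (√(1 - 2 * μ))⁻¹ ≤ Real.exp (μ + 4 * μ ^ 2) := by
  have h0 := abs_le.1 hμ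
  have hx : |2 * μ| ≤ 1 / 2 := by rw [abs_mul, abs_two]; linarith
  have h1 := Real.abs_log_sub_add_sum_range_le (x := 2 * μ) (by linarith) 1
  simp only [Finset.range_one, Finset.sum_singleton, zero_add, pow_one, Nat.cast_zero,
    div_one] at h1
  have hpos : 0 < 1 - 2 * μ := by linarith
  have h2 : |2 * μ| ^ (1 + 1) / (1 - |2 * μ|) ≤ 8 * μ ^ 2 := by
    rw [div_le_iff₀ (by linarith), show |2 * μ| ^ (1 + 1) = 4 * μ ^ 2 by
      rw [sq_abs]; ring]
    nlinarith [sq_nonneg μ]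
  have h3 := neg_abs_le (2 * μ + Real.log (1 - 2 * μ))
  rw [← Real.exp_log (inv_pos.2 (Real.sqrt_pos.2 hpos)), Real.log_inv, Real.log_sqrt hpos.le]
  apply Real.exp_le_exp.2
  linarith

/-- Chernoff bounds with parameters `± s / (4 ρ)`, `ρ = √(n/s)`. The deviation `21 ρ` contributes
`-21 s / 4` and the quadratic term `s / 4`, in total `-5 s`, enough to beat a net of `5 ^ s` points.
-/
theorem gaussianVector_abs_sum_sq_sub_ge_le [Nonempty ι] {s : ℕ} (hs : 1 ≤ s)
    (hsn : s ≤ Fintype.card ι) :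
    (gaussianVector ι (s : ℝ≥0)⁻¹).real
      {x | 21 * √((Fintype.card ι : ℝ) / s) ≤ |∑ i, x i ^ 2 - (Fintype.card ι : ℝ) / s|} ≤
      2 * Real.exp (-(5 * s)) := by
  have hs0 : (0 : ℝ) < s := by exact_mod_cast hs
  have hv : (s : ℝ≥0)⁻¹ ≠ 0 := by simp; omega
  set n : ℝ := (Fintype.card ι : ℝ) with hn
  have hn0 : 0 < n := by rw [hn]; exact_mod_cast Fintype.card_pos
  have hsn' : (s : ℝ) ≤ n := by rw [hn]; exact_mod_cast hsn
  set ρ := √(n / s) with hρ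
  have hρ1 : 1 ≤ ρ := by
    rw [hρ, Real.one_le_sqrt, one_le_div hs0]; exact hsn'
  have hρ0 : 0 < ρ := by linarith
  have hρ2 : n = ρ ^ 2 * s := by
    rw [hρ, Real.sq_sqrt (by positivity)]; field_simp
  set μ := (4 * ρ)⁻¹ with hμ
  have hμ0 : 0 < μ := by positivity
  have hμρ : μ * ρ = 1 / 4 := by rw [hμ]; field_simp
  have hμ4 : μ ≤ 1 / 4 := by nlinarith
  have hpw : ∀ ν : ℝ, |ν| ≤ 1 / 4 → (√(1 - 2 * ν))⁻¹ ^ Fintype.card ι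
      ≤ Real.exp (n * (ν + 4 * ν ^ 2)) := fun ν hν => by
    rw [hn, Real.exp_nat_mul]
    exact pow_le_pow_left₀ (by positivity) (inv_sqrt_one_sub_le hν) _
  have hcoe : ∀ ν : ℝ, 2 * (ν * s) * ((s : ℝ≥0)⁻¹ : ℝ≥0) = 2 * ν := fun ν => by
    push_cast; field_simp
  have hup := gaussianVector_sum_sq_ge_le (ι := ι) hv (a := μ * s) (by positivity)
    (by rw [hcoe]; linarith) (n / s + 21 * ρ)
  have hlo := gaussianVector_sum_sq_le_le (ι := ι) hv (a := -μ * s)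
    (by nlinarith [mul_pos hμ0 hs0]) (n / s - 21 * ρ)
  rw [hcoe] at hup hlo
  have hns : n / s = ρ ^ 2 := by rw [hρ2]; field_simp
  have hμn : μ ^ 2 * n = s / 16 := by
    rw [hρ2, show μ ^ 2 * (ρ ^ 2 * s) = (μ * ρ) ^ 2 * s by ring, hμρ]; ring
  have hup' := hup.trans (mul_le_mul_of_nonneg_left
    (hpw μ (by rw [abs_of_pos hμ0]; exact hμ4)) (Real.exp_nonneg _))
  have hlo' := hlo.trans (mul_le_mul_of_nonneg_left
    (hpw (-μ) (by rw [abs_neg, abs_of_pos hμ0]; exact hμ4)) (Real.exp_nonneg _))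
  rw [← Real.exp_add] at hup' hlo'
  have e1 : -(μ * s) * (n / s + 21 * ρ) + n * (μ + 4 * μ ^ 2) = -(5 * s) := by
    have : -(μ * s) * (n / s + 21 * ρ) = -(μ * n) - 21 * (μ * ρ) * s := by field_simp; ring
    rw [this, hμρ]; linarith
  have e2 : -(-μ * s) * (n / s - 21 * ρ) + n * (-μ + 4 * (-μ) ^ 2) = -(5 * s) := by
    have : -(-μ * s) * (n / s - 21 * ρ) = μ * n - 21 * (μ * ρ) * s := by field_simp
    rw [this, hμρ]; linarith
  rw [e1] at hup'
  rw [e2] at hlo'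
  have hsub : {x : ι → ℝ | 21 * ρ ≤ |∑ i, x i ^ 2 - n / s|} ⊆
      {x | n / s + 21 * ρ ≤ ∑ i, x i ^ 2} ∪ {x | ∑ i, x i ^ 2 ≤ n / s - 21 * ρ} := by
    intro x hx
    simp only [Set.mem_ofPred_eq] at hx
    rcases le_abs.1 hx with h | h
    · left; simp only [Set.mem_ofPred_eq]; linarith
    · right; simp only [Set.mem_ofPred_eq]; linarith
  calc _ ≤ _ := measureReal_mono hsub
    _ ≤ _ := measureReal_union_le _ _
    _ ≤ _ := by linarith

theorem gaussianRows_abs_vecMul_sq_sub_ge_le [DecidableEq ι] [Nonempty κ] [Nonempty ι]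
    (hsn : Fintype.card ι ≤ Fintype.card κ) {u : ι → ℝ} (hu : u ⬝ᵥ u = 1) :
    (gaussianRows ι κ (Fintype.card ι : ℝ≥0)⁻¹).real
      {P | 21 * √((Fintype.card κ : ℝ) / Fintype.card ι) ≤
        |∑ j, (Function.swap P j ⬝ᵥ u) ^ 2 - (Fintype.card κ : ℝ) / Fintype.card ι|} ≤
      2 * Real.exp (-(5 * Fintype.card ι)) := by
  have h1 := gaussianVector_abs_sum_sq_sub_ge_le (ι := κ) (s := Fintype.card ι)
    Fintype.card_pos hsn
  have hm : Measurable fun (Q : κ → ι → ℝ) j => Q j ⬝ᵥ u := by unfold dotProduct; fun_prop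
  have hsw : Measurable (Function.swap : (ι → κ → ℝ) → κ → ι → ℝ) := by
    unfold Function.swap; fun_prop
  rwa [← gaussianRows_map_mulVec (κ := ι) _ hu, map_measureReal_apply hm
    (measurableSet_le (by fun_prop) (by fun_prop)), ← gaussianRows_map_swap,
    map_measureReal_apply hsw
      (hm (measurableSet_le (by fun_prop) (by fun_prop)))] at h1

/-- Divide by `N = ‖C 0‖²`: the event forces `N` plus the squared projections of the other columns
onto the direction of `C 0` below `4/25`. Given `C 0`, those projections are `m` independent
Gaussians. Retaining `N` and integrating over `C 0` supplies the further factor `3⁻¹ ^ s`, needed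
when `n` is close to `s`. -/
theorem gaussianRows_gram_column_lt_le [DecidableEq ι] [Nonempty ι] (m : ℕ) :
    (gaussianRows (Fin (m + 1)) ι (Fintype.card ι : ℝ≥0)⁻¹).real
      {C | ∑ j, (C j ⬝ᵥ C 0) ^ 2 < 4 / 25 * (C 0 ⬝ᵥ C 0)} ≤
      Real.exp (16 / 25 * Fintype.card ι) * (3⁻¹) ^ (Fintype.card ι + m) := by
  set s : ℝ := (Fintype.card ι : ℝ) with hs
  set v : ℝ≥0 := (Fintype.card ι : ℝ≥0)⁻¹ with hv
  have hv0 : v ≠ 0 := by simp [hv]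
  have hs0 : 0 < s := by rw [hs]; exact_mod_cast Fintype.card_pos
  have h9 : (√(1 - 2 * (-(4 * s)) * v))⁻¹ = 3⁻¹ := by
    congr 1
    rw [hv, NNReal.coe_inv, NNReal.coe_natCast, ← hs,
      show 1 - 2 * -(4 * s) * s⁻¹ = 3 ^ 2 by field_simp; norm_num]
    exact Real.sqrt_sq (by norm_num)
  have hcond : ∀ h : ι → ℝ, (gaussianRows (Fin m) ι v).real
      {R | (h ⬝ᵥ h) ^ 2 + ∑ j, (R j ⬝ᵥ h) ^ 2 < 4 / 25 * (h ⬝ᵥ h)} ≤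
      Real.exp (16 / 25 * s) * (3⁻¹) ^ m * Real.exp (-(4 * s) * ∑ i, h i ^ 2) := by
    intro h
    have hN : ∑ i, h i ^ 2 = h ⬝ᵥ h := by simp [dotProduct, pow_two]
    rw [hN]
    rcases eq_or_lt_of_le (show 0 ≤ h ⬝ᵥ h by rw [← hN]; positivity) with h0 | h0
    · have : {R : Fin m → ι → ℝ | (h ⬝ᵥ h) ^ 2 + ∑ j, (R j ⬝ᵥ h) ^ 2 < 4 / 25 * (h ⬝ᵥ h)} = ∅ := by
        ext R
        simp only [← h0, Set.mem_ofPred_eq, Set.mem_empty_iff_false, iff_false, not_lt]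
        simp only [mul_zero]
        positivity
      rw [this, measureReal_empty]
      positivity
    · set N := h ⬝ᵥ h with hNd
      set g : ι → ℝ := (√N)⁻¹ • h with hg
      have hsq : (√N)⁻¹ * (√N)⁻¹ * N = 1 := by
        rw [← mul_inv, Real.mul_self_sqrt h0.le, inv_mul_cancel₀ h0.ne']
      have hg1 : g ⬝ᵥ g = 1 := by
        rw [hg, smul_dotProduct, dotProduct_smul, smul_eq_mul, smul_eq_mul, ← mul_assoc]
        exact hsq
      have hsub : {R : Fin m → ι → ℝ | N ^ 2 + ∑ j, (R j ⬝ᵥ h) ^ 2 < 4 / 25 * N} ⊆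
          {R | ∑ j, (R j ⬝ᵥ g) ^ 2 ≤ 4 / 25 - N} := by
        intro R hR
        simp only [Set.mem_ofPred_eq] at hR ⊢
        have h2 : ∑ j, (R j ⬝ᵥ h) ^ 2 = N * ∑ j, (R j ⬝ᵥ g) ^ 2 := by
          rw [Finset.mul_sum]
          refine Finset.sum_congr rfl fun j _ => ?_
          rw [hg, dotProduct_smul, smul_eq_mul, mul_pow, ← mul_assoc, pow_two (√N)⁻¹,
            mul_comm N, hsq, one_mul]
        rw [h2] at hR
        nlinarith
      refine (measureReal_mono hsub).trans ?_
      have h3 := gaussianVector_sum_sq_le_le (ι := Fin m) hv0 (a := -(4 * s)) (by linarith)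
        (4 / 25 - N)
      rw [← gaussianRows_map_mulVec (κ := ι) _ hg1, map_measureReal_apply
        (by unfold dotProduct; fun_prop) (measurableSet_le (by fun_prop) (by fun_prop)), h9,
        Fintype.card_fin] at h3
      refine h3.trans (le_of_eq ?_)
      rw [mul_right_comm, ← Real.exp_add]
      congr 2
      ring
  have hmp := measurePreserving_piFinSuccAbove
    (fun _ : Fin (m + 1) => gaussianVector ι v) 0
  set S : Set ((ι → ℝ) × (Fin m → ι → ℝ)) :=
    {p | (p.1 ⬝ᵥ p.1) ^ 2 + ∑ j, (p.2 j ⬝ᵥ p.1) ^ 2 < 4 / 25 * (p.1 ⬝ᵥ p.1)} with hSd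
  have hS : MeasurableSet S := by
    unfold S dotProduct
    exact measurableSet_lt (by fun_prop) (by fun_prop)
  have hpre : {C : Fin (m + 1) → ι → ℝ | ∑ j, (C j ⬝ᵥ C 0) ^ 2 < 4 / 25 * (C 0 ⬝ᵥ C 0)} =
      MeasurableEquiv.piFinSuccAbove (fun _ : Fin (m + 1) => ι → ℝ) 0 ⁻¹' S := by
    ext C
    simp [S, Fin.sum_univ_succ, Fin.tail, MeasurableEquiv.piFinSuccAbove,
      Fin.insertNthEquiv]
  have hint : Integrable (fun h : ι → ℝ => Real.exp (16 / 25 * s) * (3⁻¹) ^ m *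
      Real.exp (-(4 * s) * ∑ i, h i ^ 2)) (gaussianVector ι v) :=
    (integrable_exp_sum_sq_gaussianVector hv0 (by
      nlinarith [NNReal.coe_nonneg v, mul_nonneg hs0.le (NNReal.coe_nonneg v)])).const_mul _
  have hmgf := mgf_sum_sq_gaussianVector (ι := ι) hv0 (a := -(4 * s)) (by
    nlinarith [NNReal.coe_nonneg v, mul_nonneg hs0.le (NNReal.coe_nonneg v)])
  rw [hpre, measureReal_def]
  erw [hmp.measure_preimage hS.nullMeasurableSet]
  refine ENNReal.toReal_le_of_le_ofReal (by positivity) ?_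
  rw [Measure.prod_apply hS]
  calc _ ≤ ∫⁻ h, ENNReal.ofReal (Real.exp (16 / 25 * s) * (3⁻¹) ^ m *
      Real.exp (-(4 * s) * ∑ i, h i ^ 2)) ∂gaussianVector ι v := by
        refine lintegral_mono fun h => ?_
        rw [← ENNReal.ofReal_toReal (measure_ne_top _ _)]
        exact ENNReal.ofReal_le_ofReal (hcond h)
    _ = ENNReal.ofReal (Real.exp (16 / 25 * s) * (3⁻¹) ^ m * (3⁻¹) ^ Fintype.card ι) := by
        rw [← ofReal_integral_eq_lintegral_ofReal hint
          (Filter.Eventually.of_forall fun h => by positivity), integral_const_mul]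
        rw [mgf, h9] at hmgf
        rw [hmgf]
    _ ≤ _ := ENNReal.ofReal_le_ofReal (le_of_eq (by rw [pow_add]; ring))

/-- Independently of `g`, the vector `Pᵀ P g` is unlikely to be short compared to `P g`. -/
theorem gaussianRows_gram_lt_le [DecidableEq ι] [Nonempty ι] (m : ℕ) {g : Fin (m + 1) → ℝ}
    (hg : g ⬝ᵥ g = 1) :
    (gaussianRows ι (Fin (m + 1)) (Fintype.card ι : ℝ≥0)⁻¹).real
      {P | ∑ j, (Function.swap P j ⬝ᵥ fun i => P i ⬝ᵥ g) ^ 2 <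
        4 / 25 * ∑ i, (P i ⬝ᵥ g) ^ 2} ≤
      Real.exp (16 / 25 * Fintype.card ι) * (3⁻¹) ^ (Fintype.card ι + m) := by
  have h1 := gaussianRows_gram_column_lt_le (ι := ι) m
  have hn : ‖(WithLp.toLp 2 g : EuclideanSpace ℝ (Fin (m + 1)))‖
      = ‖EuclideanSpace.single (0 : Fin (m + 1)) (1 : ℝ)‖ := by
    rw [EuclideanSpace.norm_eq]
    simp only [dotProduct] at hg
    simp [pow_two, hg]
  obtain ⟨U, hU⟩ := exists_isometry_apply_eq hn
  have hsw : Measurable (Function.swap : (ι → Fin (m + 1) → ℝ) → Fin (m + 1) → ι → ℝ) := by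
    unfold Function.swap; fun_prop
  have hS : MeasurableSet {C : Fin (m + 1) → ι → ℝ |
      ∑ j, (C j ⬝ᵥ C 0) ^ 2 < 4 / 25 * (C 0 ⬝ᵥ C 0)} := by
    unfold dotProduct
    exact measurableSet_lt (by fun_prop) (by fun_prop)
  rw [← gaussianRows_map_swap, map_measureReal_apply hsw hS, ← gaussianRows_map_isometry _ U,
    map_measureReal_apply (by fun_prop) (hsw hS)] at h1
  refine le_trans (le_of_eq ?_) h1
  congr 1
  ext P
  -- After rotating every row by `U`, column `0` is `P g`, while the norm of `Pᵀ P g` is unchanged.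
  have hcol : ∀ i, (U (WithLp.toLp 2 (P i))).ofLp 0 = P i ⬝ᵥ g := fun i => by
    have h2 : inner ℝ (U (WithLp.toLp 2 g)) (U (WithLp.toLp 2 (P i))) = P i ⬝ᵥ g := by
      rw [U.inner_map_map]
      simp [EuclideanSpace.inner_eq_star_dotProduct]
    rw [hU, EuclideanSpace.inner_single_left] at h2
    simpa using h2
  have hsum : ∑ j, ((fun i => (U (WithLp.toLp 2 (P i))).ofLp j) ⬝ᵥ fun i => P i ⬝ᵥ g) ^ 2 =
      ∑ j, (Function.swap P j ⬝ᵥ fun i => P i ⬝ᵥ g) ^ 2 := by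
    have h3 : ‖U (∑ i, (P i ⬝ᵥ g) • WithLp.toLp 2 (P i))‖ ^ 2
        = ‖∑ i, (P i ⬝ᵥ g) • (WithLp.toLp 2 (P i) : EuclideanSpace ℝ (Fin (m + 1)))‖ ^ 2 := by
      rw [U.norm_map]
    rw [map_sum, EuclideanSpace.real_norm_sq_eq, EuclideanSpace.real_norm_sq_eq] at h3
    simpa [dotProduct, mul_comm] using h3
  change _ ↔ ∑ j, ((fun i => (U (WithLp.toLp 2 (P i))).ofLp j) ⬝ᵥ
    fun i => (U (WithLp.toLp 2 (P i))).ofLp 0) ^ 2 <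
      4 / 25 * ((fun i => (U (WithLp.toLp 2 (P i))).ofLp 0) ⬝ᵥ
        fun i => (U (WithLp.toLp 2 (P i))).ofLp 0)
  rw [funext hcol, hsum]
  simp [dotProduct, pow_two]

end Tails

/-! ### Nets on the sphere and quadratic forms controlled on them. -/

section Nets

variable {V F : Type*} [NormedAddCommGroup V] [InnerProductSpace ℝ V] [FiniteDimensional ℝ V]
  [NormedAddCommGroup F] [InnerProductSpace ℝ F]

variable (V) in
/-- The sphere of radius `2` has a `1`-net of cardinality at most `5 ^ dim V`. -/
theorem exists_net_sphere : ∃ N : Finset V, (∀ c ∈ N, ‖c‖ = 2) ∧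
    N.card ≤ 5 ^ Module.finrank ℝ V ∧ ∀ u : V, ‖u‖ = 2 → ∃ c ∈ N, ‖u - c‖ < 1 := by
  classical
  have hcard : ∀ N : Finset V, (∀ c ∈ N, ‖c‖ = 2) → (∀ c ∈ N, ∀ d ∈ N, c ≠ d → 1 ≤ ‖c - d‖) →
      N.card ≤ 5 ^ Module.finrank ℝ V := fun N h1 h2 =>
    Besicovitch.card_le_of_separated N (fun c hc => (h1 c hc).le) h2
  -- If no separated set were a net, each could be enlarged by a point, past the cardinality bound.
  -- Radius 2 and separation 1 are the normalization of `Besicovitch.card_le_of_separated`.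
  by_contra! hno
  have hbig : ∀ k : ℕ, ∃ N : Finset V, N.card = k ∧ (∀ c ∈ N, ‖c‖ = 2) ∧
      (∀ c ∈ N, ∀ d ∈ N, c ≠ d → 1 ≤ ‖c - d‖) := by
    intro k
    induction k with
    | zero => exact ⟨∅, by simp⟩
    | succ k ih =>
      obtain ⟨N, hN, h1, h2⟩ := ih
      obtain ⟨u, hu, hu1⟩ := hno N h1 (hcard N h1 h2)
      have huN : u ∉ N := fun h => by
        have := hu1 u h
        rw [sub_self, norm_zero] at this
        linarith
      refine ⟨insert u N, by rw [Finset.card_insert_of_notMem huN, hN], ?_, ?_⟩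
      · simpa [hu] using h1
      · intro c hc d hd hcd
        rw [Finset.mem_insert] at hc hd
        rcases hc with rfl | hc <;> rcases hd with rfl | hd
        · exact absurd rfl hcd
        · exact hu1 d hd
        · rw [norm_sub_rev]; exact hu1 c hc
        · exact h2 c hc d hd hcd
  obtain ⟨N, hN, h1, h2⟩ := hbig (5 ^ Module.finrank ℝ V + 1)
  have := hcard N h1 h2
  omega

/-- A quadratic form `‖T u‖² - α ‖u‖²` that is small on a net is small everywhere. -/
theorem norm_sq_le_of_net {T : V →ₗ[ℝ] F} {N : Finset V} (hN : ∀ c ∈ N, ‖c‖ = 2)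
    (hcov : ∀ u : V, ‖u‖ = 2 → ∃ c ∈ N, ‖u - c‖ < 1) {α r : ℝ}
    (h : ∀ c ∈ N, |‖T c‖ ^ 2 - α * ‖c‖ ^ 2| ≤ 4 * r) (u : V) :
    ‖T u‖ ^ 2 ≤ (α + 32 * r) * ‖u‖ ^ 2 := by
  rcases eq_or_ne u 0 with rfl | hu0
  · simp
  set q : V → ℝ := fun a => ‖T a‖ ^ 2 - α * ‖a‖ ^ 2 with hq
  have hTc : Continuous T := T.continuous_of_finiteDimensional
  have hqc : Continuous fun a => |q a| := by unfold q; fun_prop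
  have hqs : ∀ (c : ℝ) a, q (c • a) = c ^ 2 * q a := fun c a => by
    simp only [hq, map_smul, norm_smul, mul_pow, Real.norm_eq_abs, sq_abs]; ring
  have hsph : ∀ a : V, a ≠ 0 → (2 / ‖a‖) • a ∈ Metric.sphere (0 : V) 2 := fun a ha => by
    rw [mem_sphere_zero_iff_norm, norm_smul, Real.norm_eq_abs, abs_of_nonneg (by positivity)]
    have := norm_pos_iff.2 ha
    field_simp
  obtain ⟨w, hw, hmax⟩ := (isCompact_sphere (0 : V) 2).exists_isMaxOn ⟨_, hsph u hu0⟩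
    hqc.continuousOn
  rw [mem_sphere_zero_iff_norm] at hw
  set m := |q w| / 4 with hm
  have hm0 : 0 ≤ m := by positivity
  have hqm : ∀ a, |q a| ≤ m * ‖a‖ ^ 2 := by
    intro a
    rcases eq_or_ne a 0 with rfl | ha
    · simp [hq]
    · have h1 : |q ((2 / ‖a‖) • a)| ≤ |q w| := hmax (hsph a ha)
      have hpos := norm_pos_iff.2 ha
      rw [hqs, abs_mul, abs_of_nonneg (by positivity), div_pow, div_mul_eq_mul_div,
        div_le_iff₀ (by positivity)] at h1
      rw [hm]; linarith
  obtain ⟨c, hcN, hc⟩ := hcov w hw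
  -- Polarization, after rescaling both vectors to the common length `‖a‖ ‖b‖`, loses no constant.
  have hbil : ∀ a b, |inner ℝ (T a) (T b) - α * inner ℝ a b| ≤ m * (‖a‖ * ‖b‖) := by
    intro a b
    rcases eq_or_ne a 0 with rfl | ha
    · simp
    rcases eq_or_ne b 0 with rfl | hb
    · simp
    have ha := norm_pos_iff.2 ha
    have hb := norm_pos_iff.2 hb
    have h1 := abs_le.1 (hqm (‖b‖ • a + ‖a‖ • b))
    have h2 := abs_le.1 (hqm (‖b‖ • a - ‖a‖ • b))
    have e1 : q (‖b‖ • a + ‖a‖ • b) - q (‖b‖ • a - ‖a‖ • b) =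
        4 * (‖a‖ * ‖b‖) * (inner ℝ (T a) (T b) - α * inner ℝ a b) := by
      simp only [hq, map_add, map_sub, map_smul, norm_add_sq_real, norm_sub_sq_real,
        inner_smul_left, inner_smul_right, RCLike.conj_to_real]
      ring
    have e2 : ‖‖b‖ • a + ‖a‖ • b‖ ^ 2 + ‖‖b‖ • a - ‖a‖ • b‖ ^ 2 = 4 * (‖a‖ * ‖b‖) ^ 2 := by
      simp only [norm_add_sq_real, norm_sub_sq_real, norm_smul, Real.norm_eq_abs, abs_norm]
      ring
    have hab : 0 < 4 * (‖a‖ * ‖b‖) := by positivity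
    have e3 : m * ‖‖b‖ • a + ‖a‖ • b‖ ^ 2 + m * ‖‖b‖ • a - ‖a‖ • b‖ ^ 2 =
        4 * (‖a‖ * ‖b‖) * (m * (‖a‖ * ‖b‖)) := by
      rw [← mul_add, e2]; ring
    rw [abs_le]
    constructor
    · refine le_of_mul_le_mul_left ?_ hab
      rw [← e1, mul_neg, ← e3]; linarith
    · refine le_of_mul_le_mul_left ?_ hab
      rw [← e1, ← e3]; linarith
  have hdiff : q w - q c = inner ℝ (T (w - c)) (T (w + c)) - α * inner ℝ (w - c) (w + c) := by
    simp only [hq, map_add, map_sub, inner_add_right, inner_sub_left, ← real_inner_self_eq_norm_sq,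
      real_inner_comm (T w) (T c), real_inner_comm w c]
    ring
  -- The parallelogram law bounds the product by `√15 < 31/8 < 4`. The gap `4 - 31/8 = 1/8` gives `m
  -- / 8 ≤ 4 r`, the source of `32 r`.
  have hprod : ‖w - c‖ * ‖w + c‖ ≤ 31 / 8 := by
    have hpar : ‖w + c‖ ^ 2 + ‖w - c‖ ^ 2 = 16 := by
      have := parallelogram_law_with_norm ℝ w c
      rw [hw, hN c hcN] at this
      linarith
    have hx : ‖w - c‖ ^ 2 ≤ 1 := by
      have := norm_nonneg (w - c)
      nlinarith
    refine le_of_sq_le_sq ?_ (by norm_num)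
    rw [mul_pow, show ‖w + c‖ ^ 2 = 16 - ‖w - c‖ ^ 2 by linarith]
    nlinarith
  have hqw : |q w| ≤ 4 * r + m * (31 / 8) := by
    have h1 : |q w - q c| ≤ m * (31 / 8) := by
      rw [hdiff]
      exact (hbil _ _).trans (by gcongr)
    have h2 := h c hcN
    calc |q w| = |q c + (q w - q c)| := by congr 1; ring
      _ ≤ |q c| + |q w - q c| := abs_add_le _ _
      _ ≤ _ := by linarith
  have hmr : m ≤ 32 * r := by
    have : |q w| = 4 * m := by rw [hm]; ring
    linarith
  have h3 := (le_abs_self _).trans (hqm u)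
  have h4 : m * ‖u‖ ^ 2 ≤ 32 * r * ‖u‖ ^ 2 := by gcongr
  simp only [hq] at h3
  linarith

end Nets

/-! ### Operator norm of a Gaussian matrix. -/

section RandomMatrices

theorem gaussianMatrix_real_apply {s n : ℕ} {S : Set (Matrix (Fin s) (Fin n) ℝ)}
    (hS : MeasurableSet S) :
    (gaussianMatrix s n).real S =
      (gaussianRows (Fin s) (Fin n) (s : ℝ≥0)⁻¹).real (Matrix.of ⁻¹' S) := by
  have hof : Measurable (Matrix.of : (Fin s → Fin n → ℝ) ≃ Matrix (Fin s) (Fin n) ℝ) :=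
    measurable_id
  rw [gaussianMatrix, map_measureReal_apply hof hS]

theorem measurable_matrix_entry {s n : ℕ} (i : Fin s) (j : Fin n) :
    Measurable fun P : Matrix (Fin s) (Fin n) ℝ => P i j :=
  (measurable_pi_apply j).comp (measurable_pi_apply i)

/-- Union bound over at most `5 ^ s ≤ exp (2 s)` net points, each failing with probability at most
`2 exp (-5 s)`. Off the bad set the squared norm is at most `ρ² + 32 · 21 ρ ≤ (ρ + 336)²`. -/
theorem exists_norm_transpose_le {s n : ℕ} (hs : 1 ≤ s) (hsn : s ≤ n) :
    ∃ A : Set (Matrix (Fin s) (Fin n) ℝ), MeasurableSet A ∧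
      (gaussianMatrix s n).real A ≤ Real.exp (-s) / 2 ∧
      ∀ P ∉ A, ∀ u : E s, ‖(WithLp.toLp 2 (Pᵀ *ᵥ u.ofLp) : E n)‖ ≤ (√((n : ℝ) / s) + 336) * ‖u‖ := by
  have : NeZero s := ⟨by omega⟩
  have : NeZero n := ⟨by omega⟩
  have hs0 : (0 : ℝ) < s := by exact_mod_cast hs
  obtain ⟨N, hN, hcard, hcov⟩ := exists_net_sphere (E s)
  set ρ := √((n : ℝ) / s) with hρ
  set bad : E s → Set (Matrix (Fin s) (Fin n) ℝ) := fun c =>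
    {P | 21 * ρ ≤ |∑ j, ((fun i => P i j) ⬝ᵥ ((1 / 2 : ℝ) • c.ofLp)) ^ 2 - (n : ℝ) / s|} with hbad
  have hbm : ∀ c, MeasurableSet (bad c) := fun c => by
    have := fun i j => measurable_matrix_entry (s := s) (n := n) i j
    unfold bad dotProduct
    exact measurableSet_le (by fun_prop) (by fun_prop)
  refine ⟨⋃ c ∈ N, bad c, N.measurableSet_biUnion fun c _ => hbm c, ?_, ?_⟩
  · have hb : ∀ c ∈ N, (gaussianMatrix s n).real (bad c) ≤ 2 * Real.exp (-(5 * s)) := by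
      intro c hc
      have hu : ((1 / 2 : ℝ) • c.ofLp) ⬝ᵥ ((1 / 2 : ℝ) • c.ofLp) = 1 := by
        have h1 : ‖c‖ ^ 2 = c.ofLp ⬝ᵥ c.ofLp := by
          rw [EuclideanSpace.real_norm_sq_eq]; simp [dotProduct, pow_two]
        rw [smul_dotProduct, dotProduct_smul, ← h1, hN c hc]
        norm_num
      have := gaussianRows_abs_vecMul_sq_sub_ge_le (ι := Fin s) (κ := Fin n) (by simpa using hsn) hu
      rw [gaussianMatrix_real_apply (hbm c)]
      simp only [Fintype.card_fin] at this
      exact this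
    have h5 : (5 : ℝ) ≤ Real.exp 2 := by
      have := Real.exp_one_gt_d9
      rw [show (2 : ℝ) = 1 + 1 by norm_num, Real.exp_add]
      nlinarith
    have h2 : (2 : ℝ) ≤ Real.exp s := by
      have := Real.add_one_le_exp (s : ℝ)
      have : (1 : ℝ) ≤ s := by exact_mod_cast hs
      linarith
    have hpos := Real.exp_pos s
    calc _ ≤ ∑ c ∈ N, (gaussianMatrix s n).real (bad c) := measureReal_biUnion_finset_le _ _
      _ ≤ ∑ c ∈ N, 2 * Real.exp (-(5 * s)) := Finset.sum_le_sum hb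
      _ = N.card * (2 * Real.exp (-(5 * s))) := by rw [Finset.sum_const, nsmul_eq_mul]
      _ ≤ Real.exp (2 * s) * (2 * Real.exp (-(5 * s))) := by
          gcongr
          calc (N.card : ℝ) ≤ (5 ^ Module.finrank ℝ (E s) : ℕ) := by exact_mod_cast hcard
            _ = 5 ^ s := by simp
            _ ≤ Real.exp 2 ^ s := by gcongr
            _ = _ := by rw [← Real.exp_nat_mul, mul_comm]
      _ = 2 * Real.exp (-s) * Real.exp (-s) * Real.exp (-s) := by
          rw [mul_left_comm, ← Real.exp_add, mul_assoc, mul_assoc, ← Real.exp_add, ← Real.exp_add]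
          congr 2; ring
      _ ≤ _ := by
          rw [Real.exp_neg]
          have h3 : (Real.exp (s : ℝ))⁻¹ ≤ 1 / 2 := by
            rw [inv_le_comm₀ hpos (by norm_num)]; simpa using h2
          have h4 : 0 < (Real.exp (s : ℝ))⁻¹ := by positivity
          have h6 : (Real.exp (s : ℝ))⁻¹ * (Real.exp (s : ℝ))⁻¹ ≤ 1 / 4 := by nlinarith
          nlinarith
  · intro P hP u
    have hTmap : ∃ T : E s →ₗ[ℝ] E n, ∀ w, T w = WithLp.toLp 2 (Pᵀ *ᵥ w.ofLp) :=
      ⟨Matrix.toEuclideanLin Pᵀ, fun w => Matrix.toLpLin_apply _ _ _ _⟩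
    obtain ⟨T, hT⟩ := hTmap
    rw [← hT]
    have hnet : ∀ c ∈ N, |‖T c‖ ^ 2 - (n : ℝ) / s * ‖c‖ ^ 2| ≤ 4 * (21 * ρ) := by
      intro c hc
      have h1 : P ∉ bad c := fun h => hP (Set.mem_biUnion hc h)
      simp only [hbad, Set.mem_ofPred_eq, not_le] at h1
      have h2 : ‖T c‖ ^ 2 = 4 * ∑ j, ((fun i => P i j) ⬝ᵥ ((1 / 2 : ℝ) • c.ofLp)) ^ 2 := by
        rw [hT, EuclideanSpace.real_norm_sq_eq, Finset.mul_sum]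
        refine Finset.sum_congr rfl fun j _ => ?_
        rw [dotProduct_smul, smul_eq_mul, mul_pow]
        simp only [Matrix.mulVec, Matrix.transpose_apply]
        ring
      rw [h2, hN c hc, show ∀ a : ℝ, 4 * a - (n : ℝ) / s * 2 ^ 2 = 4 * (a - (n : ℝ) / s) by
        intro a; ring, abs_mul, abs_of_pos (by norm_num : (0 : ℝ) < 4)]
      linarith
    have h3 := norm_sq_le_of_net hN hcov hnet u
    have hρ0 : 0 ≤ ρ := Real.sqrt_nonneg _
    refine le_of_sq_le_sq (h3.trans ?_) (by positivity)
    rw [mul_pow]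
    gcongr
    have : (n : ℝ) / s = ρ ^ 2 := by rw [hρ, Real.sq_sqrt (by positivity)]
    rw [this]
    nlinarith

end RandomMatrices

/-! ### Probability that a sketch loses a fixed gradient. -/

section SketchFailure

/-- The pairs `(g, P)` for which `P` shrinks `g` by more than `1 / 10`, or `Pᵀ` shrinks `P g` by
more than `2 / 5`. -/
def sketchFailure (s n : ℕ) : Set (E n × Matrix (Fin s) (Fin n) ℝ) :=
  {p | ‖(WithLp.toLp 2 (p.2 *ᵥ p.1.ofLp) : E s)‖ < ‖p.1‖ / 10 ∨
    ‖(WithLp.toLp 2 (p.2ᵀ *ᵥ (p.2 *ᵥ p.1.ofLp)) : E n)‖ <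
      2 / 5 * ‖(WithLp.toLp 2 (p.2 *ᵥ p.1.ofLp) : E s)‖}

theorem measurable_mulVec {α ι κ : Type*} [MeasurableSpace α] [Fintype κ]
    {A : α → Matrix ι κ ℝ} {w : α → κ → ℝ} (hA : ∀ i j, Measurable fun a => A a i j)
    (hw : Measurable w) : Measurable fun a => A a *ᵥ w a := by
  refine measurable_pi_lambda _ fun i => ?_
  simp only [Matrix.mulVec, dotProduct]
  fun_prop

theorem measurableSet_sketchFailure (s n : ℕ) : MeasurableSet (sketchFailure s n) := by
  have he : ∀ i j, Measurable fun p : E n × Matrix (Fin s) (Fin n) ℝ => p.2 i j := fun i j =>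
    (measurable_matrix_entry i j).comp measurable_snd
  have h1 : Measurable fun p : E n × Matrix (Fin s) (Fin n) ℝ => p.2 *ᵥ p.1.ofLp :=
    measurable_mulVec he (by fun_prop)
  have h2 : Measurable fun p : E n × Matrix (Fin s) (Fin n) ℝ => p.2ᵀ *ᵥ (p.2 *ᵥ p.1.ofLp) :=
    measurable_mulVec (fun j i => he i j) h1
  have h3 : Measurable fun p : E n × Matrix (Fin s) (Fin n) ℝ =>
      ‖(WithLp.toLp 2 (p.2 *ᵥ p.1.ofLp) : E s)‖ := by fun_prop
  have h4 : Measurable fun p : E n × Matrix (Fin s) (Fin n) ℝ =>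
      ‖(WithLp.toLp 2 (p.2ᵀ *ᵥ (p.2 *ᵥ p.1.ofLp)) : E n)‖ := by fun_prop
  exact (measurableSet_lt h3 (by fun_prop)).union (measurableSet_lt h4 (h3.const_mul _))

theorem gaussianMatrix_sketchFailure_le {s n : ℕ} (hs : 6 ≤ s) (hsn : s ≤ n) (g : E n) :
    (gaussianMatrix s n).real (Prod.mk g ⁻¹' sketchFailure s n) ≤ 3 / 2 * Real.exp (-s) := by
  have : NeZero s := ⟨by omega⟩
  obtain ⟨m, rfl⟩ : ∃ m, n = m + 1 := ⟨n - 1, by omega⟩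
  rw [gaussianMatrix_real_apply (measurable_prodMk_left (measurableSet_sketchFailure s _))]
  rcases eq_or_ne g 0 with rfl | hg
  · have : Prod.mk (0 : E (m + 1)) ⁻¹' sketchFailure s (m + 1) = ∅ := by
      ext P
      simp [sketchFailure]
    rw [this]
    simp only [Set.preimage_empty, measureReal_empty]
    positivity
  have hg0 := norm_pos_iff.2 hg
  obtain ⟨u, hu⟩ : ∃ u : Fin (m + 1) → ℝ, u = ‖g‖⁻¹ • g.ofLp := ⟨_, rfl⟩
  have hgu : g.ofLp = ‖g‖ • u := by
    rw [hu, smul_smul, mul_inv_cancel₀ hg0.ne', one_smul]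
  have hu1 : u ⬝ᵥ u = 1 := by
    have h1 : ‖g‖ ^ 2 = g.ofLp ⬝ᵥ g.ofLp := by
      rw [EuclideanSpace.real_norm_sq_eq]; simp [dotProduct, pow_two]
    rw [hu, smul_dotProduct, dotProduct_smul, ← h1, smul_eq_mul, smul_eq_mul]
    field_simp
  have hB := gaussianRows_mulVec_sq_le_le (ι := Fin s) hu1
  have hD := gaussianRows_gram_lt_le (ι := Fin s) m hu1
  simp only [Fintype.card_fin] at hB hD
  have hsub : Matrix.of ⁻¹' (Prod.mk g ⁻¹' sketchFailure s (m + 1)) ⊆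
      {P : Fin s → Fin (m + 1) → ℝ | ∑ i, (P i ⬝ᵥ u) ^ 2 ≤ 1 / 100} ∪
      {P | ∑ j, (Function.swap P j ⬝ᵥ fun i => P i ⬝ᵥ u) ^ 2 <
        4 / 25 * ∑ i, (P i ⬝ᵥ u) ^ 2} := by
    intro P hP
    have h1 : ‖(WithLp.toLp 2 (Matrix.of P *ᵥ g.ofLp) : E s)‖ ^ 2
        = ‖g‖ ^ 2 * ∑ i, (P i ⬝ᵥ u) ^ 2 := by
      rw [EuclideanSpace.real_norm_sq_eq, Finset.mul_sum]
      refine Finset.sum_congr rfl fun i _ => ?_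
      rw [hgu, ← mul_pow, ← smul_eq_mul, ← dotProduct_smul]
      rfl
    have h2 : ‖(WithLp.toLp 2 ((Matrix.of P)ᵀ *ᵥ (Matrix.of P *ᵥ g.ofLp)) : E (m + 1))‖ ^ 2
        = ‖g‖ ^ 2 * ∑ j, (Function.swap P j ⬝ᵥ fun i => P i ⬝ᵥ u) ^ 2 := by
      rw [EuclideanSpace.real_norm_sq_eq, Finset.mul_sum]
      refine Finset.sum_congr rfl fun i _ => ?_
      rw [hgu, Matrix.mulVec_smul, Matrix.mulVec_smul, ← mul_pow]
      rfl
    have hP' : ‖(WithLp.toLp 2 (Matrix.of P *ᵥ g.ofLp) : E s)‖ < ‖g‖ / 10 ∨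
      ‖(WithLp.toLp 2 ((Matrix.of P)ᵀ *ᵥ (Matrix.of P *ᵥ g.ofLp)) : E (m + 1))‖ <
        2 / 5 * ‖(WithLp.toLp 2 (Matrix.of P *ᵥ g.ofLp) : E s)‖ := hP
    have hgg : 0 < ‖g‖ ^ 2 := by positivity
    rcases hP' with h | h
    · left
      have h3 := pow_le_pow_left₀ (norm_nonneg _) h.le 2
      rw [h1, div_pow] at h3
      simp only [Set.mem_ofPred_eq]
      refine le_of_mul_le_mul_left ?_ hgg
      linarith
    · right
      have h3 := pow_lt_pow_left₀ h (norm_nonneg _) two_ne_zero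
      rw [mul_pow, h1, h2] at h3
      simp only [Set.mem_ofPred_eq]
      refine lt_of_mul_lt_mul_left ?_ hgg.le
      linarith
  have hs6 : (6 : ℝ) ≤ s := by exact_mod_cast hs
  have h9 : Real.exp 2 ≤ 9 := by
    have h := Real.exp_one_lt_d9
    have h0 := Real.exp_pos 1
    rw [show (2 : ℝ) = 1 + 1 by norm_num, Real.exp_add]
    nlinarith
  have h9s : ((9 : ℝ)⁻¹) ^ s ≤ Real.exp (-(2 * s)) := by
    rw [inv_pow, Real.exp_neg]
    gcongr
    rw [mul_comm, Real.exp_nat_mul]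
    gcongr
  have hBle : Real.exp (2 / 5 * s) * (9⁻¹) ^ s ≤ 1 / 2 * Real.exp (-s) := by
    have h3 : (2 : ℝ) ≤ Real.exp (3 / 5 * s) := by
      have := Real.add_one_le_exp (3 / 5 * (s : ℝ))
      linarith
    calc Real.exp (2 / 5 * s) * (9⁻¹) ^ s ≤ Real.exp (2 / 5 * s) * Real.exp (-(2 * s)) := by gcongr
      _ = (Real.exp (3 / 5 * s))⁻¹ * Real.exp (-s) := by
          rw [← Real.exp_neg, ← Real.exp_add, ← Real.exp_add]; congr 1; ring
      _ ≤ (2 : ℝ)⁻¹ * Real.exp (-s) := by gcongr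
      _ = _ := by norm_num
  have hDle : Real.exp (16 / 25 * s) * (3⁻¹) ^ (s + m) ≤ Real.exp (-s) := by
    -- This is where `s ≥ 6` is needed: `1 + 9 s / 25 ≥ 3`. The factor 3 it pays for comes from `m ≥
    -- s - 1` instead of `m ≥ s`.
    have h3 : (3 : ℝ) ≤ Real.exp (9 / 25 * s) := by
      have := Real.add_one_le_exp (9 / 25 * (s : ℝ))
      linarith
    have h4 : ((3 : ℝ)⁻¹) ^ (s + m) ≤ 3 * (9⁻¹) ^ s := by
      calc ((3 : ℝ)⁻¹) ^ (s + m) ≤ (3⁻¹) ^ (s + (s - 1)) :=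
            pow_le_pow_of_le_one (by norm_num) (by norm_num) (by omega)
        _ = 3 * (3⁻¹) ^ (2 * s) := by
            rw [show 2 * s = (s + (s - 1)) + 1 by omega, pow_succ]; ring
        _ = _ := by rw [pow_mul]; norm_num
    calc Real.exp (16 / 25 * s) * (3⁻¹) ^ (s + m)
        ≤ Real.exp (16 / 25 * s) * (Real.exp (9 / 25 * s) * Real.exp (-(2 * s))) := by
          gcongr
          exact h4.trans (by gcongr)
      _ = _ := by rw [← Real.exp_add, ← Real.exp_add]; congr 1; ring
  calc _ ≤ _ := measureReal_mono hsub
    _ ≤ _ := measureReal_union_le _ _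
    _ ≤ _ := by linarith

end SketchFailure

/-! ### Measurability and independence along a run. -/

section Runs

variable {Ω : Type*} [mΩ : MeasurableSpace Ω] {μ : Measure Ω}
  {ℱ : Filtration ℕ mΩ} {s n : ℕ} {f : E n → ℝ} {δ Δ : ℝ} {x₀ : E n}
  {P : ℕ → Ω → Matrix (Fin s) (Fin n) ℝ} {y : ℕ → Ω → Hom s} {x : ℕ → Ω → E n}

theorem measurable_direction :
    Measurable fun p : Matrix (Fin s) (Fin n) ℝ × Hom s => direction p.1 p.2 := by
  have ht : Measurable fun p : Matrix (Fin s) (Fin n) ℝ × Hom s => p.2.ofLp (Sum.inr ()) := by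
    fun_prop
  have hv : Measurable fun p : Matrix (Fin s) (Fin n) ℝ × Hom s =>
      (WithLp.toLp 2 (p.1ᵀ *ᵥ fun i => p.2.ofLp (Sum.inl i)) : E n) := by
    have : Measurable fun p : Matrix (Fin s) (Fin n) ℝ × Hom s =>
        p.1ᵀ *ᵥ fun i => p.2.ofLp (Sum.inl i) :=
      measurable_mulVec (fun j i => (measurable_matrix_entry i j).comp measurable_fst)
        (by fun_prop)
    fun_prop
  exact Measurable.ite ((ht (measurableSet_singleton 0)).compl) (ht.inv.smul hv) hv

theorem measurable_nextIterate {α : Type*} {m : MeasurableSpace α} {a d : α → E n}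
    (ha : Measurable a) (hd : Measurable d) : Measurable fun z => nextIterate Δ (a z) (d z) := by
  unfold nextIterate
  exact Measurable.ite (measurableSet_lt measurable_const hd.norm) (by fun_prop) (by fun_prop)

theorem IsRun.measurable_iterate (h : IsRun μ ℱ f δ Δ x₀ P y x) (k : ℕ) :
    Measurable[ℱ k] (x k) := by
  induction k with
  | zero =>
    have : x 0 = fun _ => x₀ := funext h.init
    rw [this]
    exact measurable_const
  | succ k ih =>
    have hx : Measurable[ℱ (k + 1)] (x k) := ih.mono (ℱ.mono k.le_succ) le_rfl
    have hd : Measurable[ℱ (k + 1)] fun ω => direction (P k ω) (y k ω) :=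
      measurable_direction.comp ((h.measurable_matrix k).prodMk (h.measurable_solution k))
    have hstep : x (k + 1) = fun ω => nextIterate Δ (x k ω) (direction (P k ω) (y k ω)) :=
      funext (h.step k)
    rw [hstep]
    exact measurable_nextIterate hx hd

theorem IsRun.measure_matrix_mem (h : IsRun μ ℱ f δ Δ x₀ P y x) (k : ℕ)
    {A : Set (Matrix (Fin s) (Fin n) ℝ)} (hA : MeasurableSet A) :
    μ.real {ω | P k ω ∈ A} = (gaussianMatrix s n).real A := by
  rw [← h.law_matrix k, map_measureReal_apply ((h.measurable_matrix k).mono (ℱ.le _) le_rfl) hA]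
  rfl

/-- The gradient at `x k` is known before `P k` is drawn, so their joint law is a product; the bound
for fixed `g` integrates by Fubini. -/
theorem IsRun.measure_sketchFailure_le [IsProbabilityMeasure μ] (h : IsRun μ ℱ f δ Δ x₀ P y x)
    (hs : 6 ≤ s) (hsn : s ≤ n)
    (hf : Continuous (gradient f)) (k : ℕ) :
    μ.real {ω | (gradient f (x k ω), P k ω) ∈ sketchFailure s n} ≤ 3 / 2 * Real.exp (-s) := by
  have hP : Measurable (P k) := (h.measurable_matrix k).mono (ℱ.le _) le_rfl
  have hgF : Measurable[ℱ k] fun ω => gradient f (x k ω) :=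
    hf.measurable.comp (h.measurable_iterate k)
  have hg : Measurable fun ω => gradient f (x k ω) := hgF.mono (ℱ.le _) le_rfl
  have hind : IndepFun (fun ω => gradient f (x k ω)) (P k) μ :=
    (indep_of_indep_of_le_right (h.indep_matrix k) hgF.comap_le).symm
  have hmap := (indepFun_iff_map_prod_eq_prod_map_map hg.aemeasurable hP.aemeasurable).1 hind
  have hS := measurableSet_sketchFailure s n
  have : IsProbabilityMeasure (μ.map fun ω => gradient f (x k ω)) :=
    Measure.isProbabilityMeasure_map hg.aemeasurable
  have : IsProbabilityMeasure (gaussianMatrix s n) := by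
    rw [← h.law_matrix k]; exact Measure.isProbabilityMeasure_map hP.aemeasurable
  have h1 : μ.real {ω | (gradient f (x k ω), P k ω) ∈ sketchFailure s n} =
      (((μ.map fun ω => gradient f (x k ω)).prod (gaussianMatrix s n))).real
        (sketchFailure s n) := by
    rw [← h.law_matrix k, ← hmap, map_measureReal_apply (hg.prodMk hP) hS]
    rfl
  rw [h1, measureReal_def]
  refine ENNReal.toReal_le_of_le_ofReal (by positivity) ?_
  rw [Measure.prod_apply hS]
  calc _ ≤ ∫⁻ _, ENNReal.ofReal (3 / 2 * Real.exp (-s)) ∂(μ.map fun ω => gradient f (x k ω)) := by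
        refine lintegral_mono fun g => ?_
        rw [← ENNReal.ofReal_toReal (measure_ne_top _ _)]
        exact ENNReal.ofReal_le_ofReal (gaussianMatrix_sketchFailure_le hs hsn g)
    _ = _ := by simp

end Runs

/-! ### From the matrix subproblem to the abstract model with `T = Pᵀ`. -/

section Bridge

variable {s n : ℕ} {f : E n → ℝ}

theorem fderiv_gradient_symm (hf : ContDiff ℝ 2 f) (x u w : E n) :
    inner ℝ (fderiv ℝ (gradient f) x u) w = inner ℝ u (fderiv ℝ (gradient f) x w) := by
  have hd : DifferentiableAt ℝ (fderiv ℝ f) x :=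
    (hf.fderiv_right (m := 1) (by norm_num)).differentiable (by norm_num) x
  have h2 : ∀ a b, inner ℝ (fderiv ℝ (gradient f) x a) b = fderiv ℝ (fderiv ℝ f) x a b := by
    intro a b
    have e1 := ((differentiable_gradient hf x).hasFDerivAt.inner ℝ (hasFDerivAt_const b x))
    have e2 := hd.hasFDerivAt.clm_apply (hasFDerivAt_const b x)
    have e3 : (fun z => inner ℝ (gradient f z) b) = fun z => fderiv ℝ f z b := by
      ext z
      exact InnerProductSpace.toDual_symm_apply
    rw [e3] at e1
    simpa using DFunLike.congr_fun (e1.unique e2) a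
  have h3 : IsSymmSndFDerivAt ℝ f x := hf.contDiffAt.isSymmSndFDerivAt (by simp)
  rw [h2, real_inner_comm, h2]
  exact h3 u w

theorem hessian_mulVec (x w : E n) :
    hessian f x *ᵥ w.ofLp = (fderiv ℝ (gradient f) x w).ofLp := by
  have hw : w = ∑ j, w.ofLp j • EuclideanSpace.single j (1 : ℝ) := by
    ext i
    simp [Finset.sum_apply, Pi.single_apply]
  ext i
  conv_rhs => rw [hw]
  simp [hessian, Matrix.mulVec, dotProduct, map_sum, mul_comm]

theorem dotProduct_modelMatrix_mulVec (δ : ℝ) (x : E n) (P : Matrix (Fin s) (Fin n) ℝ)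
    (a : E s) (b : ℝ) :
    Sum.elim a.ofLp (fun _ => b) ⬝ᵥ (modelMatrix f δ x P *ᵥ Sum.elim a.ofLp fun _ => b) =
      homModel (Matrix.toEuclideanLin Pᵀ) (fderiv ℝ (gradient f) x) (gradient f x) δ a b := by
  have h1 : a.ofLp ⬝ᵥ ((P * hessian f x * Pᵀ) *ᵥ a.ofLp) =
      inner ℝ (fderiv ℝ (gradient f) x (Matrix.toEuclideanLin Pᵀ a))
        (Matrix.toEuclideanLin Pᵀ a) := by
    rw [EuclideanSpace.inner_eq_star_dotProduct, ← hessian_mulVec, Matrix.toLpLin_apply,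
      ← Matrix.mulVec_mulVec, ← Matrix.mulVec_mulVec, Matrix.dotProduct_mulVec,
      ← Matrix.mulVec_transpose]
    simp
  have h2 : inner ℝ (gradient f x) (Matrix.toEuclideanLin Pᵀ a)
      = a.ofLp ⬝ᵥ (P *ᵥ (gradient f x).ofLp) := by
    rw [EuclideanSpace.inner_eq_star_dotProduct, Matrix.toLpLin_apply, Matrix.dotProduct_mulVec,
      ← Matrix.mulVec_transpose]
    simp
  rw [modelMatrix, Matrix.fromBlocks_mulVec, Sum.elim_comp_inl, Sum.elim_comp_inr, homModel,
    ← h1, h2]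
  simp only [sumElim_dotProduct_sumElim, dotProduct_add]
  have h3 : a.ofLp ⬝ᵥ ((Matrix.of fun i _ => (P *ᵥ (gradient f x).ofLp) i) *ᵥ
      fun _ : Unit => b) = b * (a.ofLp ⬝ᵥ (P *ᵥ (gradient f x).ofLp)) := by
    simp only [dotProduct, Matrix.mulVec, Matrix.of_apply, Finset.univ_unique,
      Finset.sum_singleton]
    rw [Finset.mul_sum]
    refine Finset.sum_congr rfl fun i _ => by ring
  have h4 : (fun _ : Unit => b) ⬝ᵥ ((Matrix.of fun _ j => (P *ᵥ (gradient f x).ofLp) j) *ᵥ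
      a.ofLp) = b * (a.ofLp ⬝ᵥ (P *ᵥ (gradient f x).ofLp)) := by
    simp only [dotProduct, Matrix.mulVec, Matrix.of_apply, Finset.univ_unique,
      Finset.sum_singleton]
    congr 1
    refine Finset.sum_congr rfl fun i _ => by ring
  have h5 : (fun _ : Unit => b) ⬝ᵥ ((Matrix.of fun (_ : Unit) (_ : Unit) => -δ) *ᵥ fun _ => b) =
      -δ * b ^ 2 := by
    simp [dotProduct, Matrix.mulVec]; ring
  rw [h3, h4, h5]
  ring

theorem norm_sq_toLp_sum_elim (a : E s) (b : ℝ) :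
    ‖(WithLp.toLp 2 (Sum.elim a.ofLp fun _ => b) : Hom s)‖ ^ 2 = ‖a‖ ^ 2 + b ^ 2 := by
  rw [EuclideanSpace.real_norm_sq_eq, EuclideanSpace.real_norm_sq_eq]
  simp

theorem IsSubproblemSolution.exists_isMin {δ : ℝ} {x : E n} {P : Matrix (Fin s) (Fin n) ℝ}
    {y : Hom s} (h : IsSubproblemSolution f δ x P y) :
    ∃ (v : E s) (t : ℝ), direction P y = homDirection (Matrix.toEuclideanLin Pᵀ) v t ∧
      ‖v‖ ^ 2 + t ^ 2 ≤ 1 ∧ ∀ a b, ‖a‖ ^ 2 + b ^ 2 ≤ 1 →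
        homModel (Matrix.toEuclideanLin Pᵀ) (fderiv ℝ (gradient f) x) (gradient f x) δ v t ≤
        homModel (Matrix.toEuclideanLin Pᵀ) (fderiv ℝ (gradient f) x) (gradient f x) δ a b := by
  obtain ⟨hy, hmin⟩ := h
  have hyd : y.ofLp = Sum.elim (WithLp.toLp 2 fun i => y (Sum.inl i) : E s).ofLp
      fun _ => y (Sum.inr ()) := by
    ext i
    rcases i with i | i <;> rfl
  refine ⟨WithLp.toLp 2 fun i => y (Sum.inl i), y (Sum.inr ()), ?_, ?_, ?_⟩
  · simp only [direction, homDirection, Matrix.toLpLin_apply]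
  · rw [← norm_sq_toLp_sum_elim, ← hyd]
    rw [mem_closedBall_zero_iff] at hy
    exact pow_le_one₀ (norm_nonneg _) hy
  · intro a b hab
    rw [← norm_sq_toLp_sum_elim] at hab
    have h1 := hmin (show (WithLp.toLp 2 (Sum.elim a.ofLp fun _ => b) : Hom s) ∈
      Metric.closedBall (0 : Hom s) 1 by
        rw [mem_closedBall_zero_iff]
        exact (sq_le_one_iff₀ (norm_nonneg _)).1 hab)
    simp only [Set.mem_ofPred_eq] at h1
    rw [hyd, dotProduct_modelMatrix_mulVec] at h1
    rw [dotProduct_modelMatrix_mulVec] at h1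
    exact h1

theorem norm_fderiv_gradient_apply_le {L : ℝ≥0} (hL : LipschitzWith L (gradient f)) (x u : E n) :
    ‖fderiv ℝ (gradient f) x u‖ ≤ L * ‖u‖ :=
  (ContinuousLinearMap.le_opNorm _ _).trans (by
    gcongr; exact norm_fderiv_le_of_lipschitz ℝ hL)

theorem inner_toEuclideanLin (P : Matrix (Fin s) (Fin n) ℝ) (u : E n) (a : E s) :
    inner ℝ (Matrix.toEuclideanLin P u) a = inner ℝ u (Matrix.toEuclideanLin Pᵀ a) := by
  rw [EuclideanSpace.inner_eq_star_dotProduct, EuclideanSpace.inner_eq_star_dotProduct,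
    Matrix.toLpLin_apply, Matrix.toLpLin_apply, dotProduct_comm (Pᵀ *ᵥ _),
    Matrix.dotProduct_mulVec, Matrix.vecMul_transpose]
  simp [dotProduct_comm]

end Bridge

/-! ### One iteration: decrease after a long step, small gradient at a short one. -/

section Iteration

variable {s n : ℕ} {f : E n → ℝ} {x : E n} {P : Matrix (Fin s) (Fin n) ℝ} {y : Hom s}
  {δ Δ σ R : ℝ} {L M : ℝ≥0}

theorem nextIterate_decrease (hf : ContDiff ℝ 2 f)
    (hM : LipschitzWith M (fderiv ℝ (gradient f))) (hM0 : 0 < M) (hσ : 0 < σ) (hR : 0 < R)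
    (hδ : δ = R ^ 2 * σ) (hΔ : Δ = σ / M) (hP : ∀ u : E s, ‖Matrix.toEuclideanLin Pᵀ u‖ ≤ R * ‖u‖)
    (hy : IsSubproblemSolution f δ x P y) (hd : Δ < ‖direction P y‖) :
    f (nextIterate Δ x (direction P y)) ≤ f x - σ ^ 3 / (3 * (M : ℝ) ^ 2) := by
  obtain ⟨v, t, hdir, hvt, hmin⟩ := hy.exists_isMin
  have hM0' : (0 : ℝ) < M := hM0
  have hΔ0 : 0 < Δ := by rw [hΔ]; positivity
  rw [nextIterate, if_pos hd]
  rw [hdir] at hd ⊢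
  have h1 := model_decrease (fderiv_gradient_symm hf x) (by rw [hδ]; positivity) hvt hmin hP hδ
    hσ.le hΔ0.le hd
  have h2 := le_cubic_model hf hM x ((Δ / ‖homDirection (Matrix.toEuclideanLin Pᵀ) v t‖) •
    homDirection (Matrix.toEuclideanLin Pᵀ) v t)
  have hpos : 0 < ‖homDirection (Matrix.toEuclideanLin Pᵀ) v t‖ := hΔ0.trans hd
  rw [norm_smul, Real.norm_eq_abs, abs_of_nonneg (by positivity),
    div_mul_cancel₀ _ hpos.ne'] at h2
  have h3 : -(σ * Δ ^ 2) / 2 + M / 6 * Δ ^ 3 = -(σ ^ 3 / (3 * (M : ℝ) ^ 2)) := by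
    rw [hΔ]; field_simp; ring
  linarith

/-- The constant is `250 = 10 · 25`: a factor 10 for `‖g‖ ≤ 10 ‖P g‖`, and `2/5 - Δ ≥ 2/5 - 9/25 =
1/25`. -/
theorem norm_gradient_le_of_stop (hf : ContDiff ℝ 2 f) (hL : LipschitzWith L (gradient f))
    (hσ : 0 < σ) (hR : 1 ≤ R) (hδ : δ = R ^ 2 * σ) (hΔ0 : 0 ≤ Δ) (hΔ : Δ ≤ 9 / 25)
    (hP : ∀ u : E s, ‖Matrix.toEuclideanLin Pᵀ u‖ ≤ R * ‖u‖)
    (hg : (gradient f x, P) ∉ sketchFailure s n)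
    (hy : IsSubproblemSolution f δ x P y) (hd : ‖direction P y‖ ≤ Δ) :
    ‖gradient f x‖ ≤ 250 * (2 * L + σ) * R ^ 2 * Δ := by
  obtain ⟨v, t, hdir, hvt, hmin⟩ := hy.exists_isMin
  rw [hdir] at hd
  have h0 : ¬(‖Matrix.toEuclideanLin P (gradient f x)‖ < ‖gradient f x‖ / 10 ∨
      ‖Matrix.toEuclideanLin Pᵀ (Matrix.toEuclideanLin P (gradient f x))‖ <
        2 / 5 * ‖Matrix.toEuclideanLin P (gradient f x)‖) := by
    simp only [Matrix.toLpLin_apply]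
    exact hg
  obtain ⟨h1, h2⟩ := not_or.1 h0
  rw [not_lt] at h1 h2
  have h3 := sketched_gradient_le (fderiv_gradient_symm hf x) (by rw [hδ]; positivity) hvt hmin
    (inner_toEuclideanLin P) hP L.2 (norm_fderiv_gradient_apply_le hL x) hR hΔ0
    (by linarith : Δ ≤ 2 / 5) (by norm_num) h2 hd
  have h4 : 1 / 25 * ‖Matrix.toEuclideanLin P (gradient f x)‖ ≤
      (2 / 5 - Δ) * ‖Matrix.toEuclideanLin P (gradient f x)‖ := by
    gcongr; linarith
  rw [hδ] at h3
  have h5 : (2 * (L : ℝ) * R ^ 2 + R ^ 2 * σ) * Δ = (2 * L + σ) * R ^ 2 * Δ := by ring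
  have h6 : (2 * L.1 * R ^ 2 + R ^ 2 * σ) * Δ = (2 * (L : ℝ) * R ^ 2 + R ^ 2 * σ) * Δ := rfl
  linarith

end Iteration

/-! ### Iteration count, final accuracy and the union bound. -/

section Runs

variable {s n : ℕ} {f : E n → ℝ} {x₀ : E n} {δ Δ ε R : ℝ} {L M : ℝ≥0}

theorem rpow_neg_three_halves {a : ℝ} (ha : 0 < a) : a ^ (-(3 / 2) : ℝ) = (√a ^ 3)⁻¹ := by
  rw [Real.rpow_neg ha.le, Real.sqrt_eq_rpow, ← Real.rpow_natCast, ← Real.rpow_mul ha.le]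
  norm_num

theorem iterBound_le (hf : BddBelow (Set.range f)) (hε : 0 < ε) (hεM : ε ≤ (M : ℝ) ^ 2 / 8) :
    (iterBound f x₀ M ε : ℝ) ≤
      (3 * (M : ℝ) ^ 2 * (f x₀ - ⨅ z, f z) + ((M : ℝ) ^ 2 / 8) ^ (3 / 2 : ℝ)) *
        ε ^ (-(3 / 2) : ℝ) := by
  have h0 : 0 ≤ f x₀ - ⨅ z, f z := sub_nonneg.2 (ciInf_le hf x₀)
  have h1 : 1 ≤ ((M : ℝ) ^ 2 / 8) ^ (3 / 2 : ℝ) * ε ^ (-(3 / 2) : ℝ) := by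
    rw [Real.rpow_neg hε.le, ← div_eq_mul_inv, one_le_div (by positivity)]
    gcongr
  rw [iterBound, Nat.cast_add, Nat.cast_one, add_mul]
  gcongr
  exact Nat.floor_le (by positivity)

theorem exists_short_direction {P : ℕ → Matrix (Fin s) (Fin n) ℝ} {y : ℕ → Hom s} {x : ℕ → E n}
    (hf : ContDiff ℝ 2 f) (hb : BddBelow (Set.range f))
    (hM : LipschitzWith M (fderiv ℝ (gradient f))) (hM0 : 0 < M) (hε : 0 < ε) (hR : 0 < R)
    (hδ : δ = R ^ 2 * √ε) (hΔ : Δ = √ε / M)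
    (hP : ∀ k < iterBound f x₀ M ε, ∀ u : E s, ‖Matrix.toEuclideanLin (P k)ᵀ u‖ ≤ R * ‖u‖)
    (hy : ∀ k, IsSubproblemSolution f δ (x k) (P k) (y k)) (h0 : x 0 = x₀)
    (hstep : ∀ k, x (k + 1) = nextIterate Δ (x k) (direction (P k) (y k))) :
    ∃ k < iterBound f x₀ M ε, ‖direction (P k) (y k)‖ ≤ Δ := by
  by_contra! hno
  have hσ : 0 < √ε := Real.sqrt_pos.2 hε
  have hM0' : (0 : ℝ) < M := hM0
  set D := √ε ^ 3 / (3 * (M : ℝ) ^ 2) with hD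
  have hD0 : 0 < D := by positivity
  have hdec : ∀ k ≤ iterBound f x₀ M ε, f (x k) ≤ f x₀ - k * D := by
    intro k
    induction k with
    | zero => intro _; simp [h0]
    | succ k ih =>
      intro hk
      have h1 := ih (by omega)
      have h2 := nextIterate_decrease hf hM hM0 hσ hR hδ hΔ (hP k (by omega)) (hy k)
        (hno k (by omega))
      rw [← hstep] at h2
      push_cast
      linarith
  have h1 := hdec _ le_rfl
  have h2 : (⨅ z, f z) ≤ f (x (iterBound f x₀ M ε)) := ciInf_le hb _
  have h3 : 3 * (M : ℝ) ^ 2 * (f x₀ - ⨅ z, f z) * ε ^ (-(3 / 2) : ℝ) < iterBound f x₀ M ε := by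
    rw [iterBound, Nat.cast_add, Nat.cast_one]
    exact Nat.lt_floor_add_one _
  have h4 : 3 * (M : ℝ) ^ 2 * (f x₀ - ⨅ z, f z) * ε ^ (-(3 / 2) : ℝ)
      = (f x₀ - ⨅ z, f z) / D := by
    rw [rpow_neg_three_halves hε, hD]; field_simp
  rw [h4, div_lt_iff₀ hD0] at h3
  linarith

/-- Raise `1 ≤ c (n/s) ε^{1/τ}` to the power `τ/2` and multiply by `√ε`. -/
theorem sqrt_le_of_le_mul_rpow {c τ : ℝ} (hs : 1 ≤ s) (hsn : s ≤ n) (hc : 0 < c) (hτ : 0 < τ)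
    (hε : 0 < ε) (h : (s : ℝ) ≤ c * (n * ε ^ (1 / τ))) :
    √ε ≤ c ^ (τ / 2) * ((n : ℝ) / s) ^ (τ / 2) * ε := by
  have hs0 : (0 : ℝ) < s := by exact_mod_cast hs
  have hn0 : (0 : ℝ) < n := by exact_mod_cast (by omega : 0 < n)
  have h1 : 1 ≤ c * ((n : ℝ) / s) * ε ^ (1 / τ) := by
    rw [show c * ((n : ℝ) / s) * ε ^ (1 / τ) = c * (n * ε ^ (1 / τ)) / s by ring,
      one_le_div hs0]
    exact h
  have h2 : 1 ≤ (c * ((n : ℝ) / s) * ε ^ (1 / τ)) ^ (τ / 2) :=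
    Real.one_le_rpow h1 (by positivity)
  rw [Real.mul_rpow (by positivity) (by positivity), Real.mul_rpow (by positivity) (by positivity),
    ← Real.rpow_mul hε.le, show 1 / τ * (τ / 2) = 1 / 2 by field_simp, ← Real.sqrt_eq_rpow] at h2
  calc √ε = 1 * √ε := (one_mul _).symm
    _ ≤ c ^ (τ / 2) * ((n : ℝ) / s) ^ (τ / 2) * √ε * √ε := by gcongr
    _ = _ := by rw [mul_assoc, Real.mul_self_sqrt hε.le]

/-- The deterministic part: a run whose sketches are all well behaved stops in time, with
small gradients. -/
theorem exists_stopsAt {P : ℕ → Matrix (Fin s) (Fin n) ℝ} {y : ℕ → Hom s} {x : ℕ → E n}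
    {c τ : ℝ} (hs : 1 ≤ s) (hsn : s ≤ n) (hc : 0 < c) (hτ : 0 < τ)
    (hf : ContDiff ℝ 2 f) (hb : BddBelow (Set.range f)) (hL : LipschitzWith L (gradient f))
    (hM : LipschitzWith M (fderiv ℝ (gradient f))) (hε : 0 < ε) (hεM : ε ≤ (M : ℝ) ^ 2 / 8)
    (hδ : δ = (√((n : ℝ) / s) + 336) ^ 2 * √ε) (hΔ : Δ = √ε / M)
    (hsc : (s : ℝ) ≤ c * (n * ε ^ (1 / τ)))
    (hP : ∀ k < iterBound f x₀ M ε, ∀ u : E s,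
      ‖(WithLp.toLp 2 ((P k)ᵀ *ᵥ u.ofLp) : E n)‖ ≤ (√((n : ℝ) / s) + 336) * ‖u‖)
    (hg : ∀ k < iterBound f x₀ M ε, (gradient f (x k), P k) ∉ sketchFailure s n)
    (hy : ∀ k, IsSubproblemSolution f δ (x k) (P k) (y k)) (h0 : x 0 = x₀)
    (hstep : ∀ k, x (k + 1) = nextIterate Δ (x k) (direction (P k) (y k))) :
    ∃ k < iterBound f x₀ M ε, StopsAt Δ P y k ∧
      ‖gradient f (x k)‖ ≤ ((250 * 337 ^ 2 * (2 * L + M) / M + L / M) * c ^ (τ / 2) + 1) *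
        ((n : ℝ) / s) ^ ((2 + τ) / 2) * ε ∧
      ‖gradient f (x (k + 1))‖ ≤ ((250 * 337 ^ 2 * (2 * L + M) / M + L / M) * c ^ (τ / 2) + 1) *
        ((n : ℝ) / s) ^ ((2 + τ) / 2) * ε := by
  classical
  have hs0 : (0 : ℝ) < s := by exact_mod_cast hs
  have hσ : 0 < √ε := Real.sqrt_pos.2 hε
  have hM0 : (0 : ℝ) < M := by
    rcases eq_or_lt_of_le M.2 with h | h
    · have h' : (M : ℝ) = 0 := h.symm
      rw [h'] at hεM
      norm_num at hεM
      linarith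
    · exact h
  set ρ := √((n : ℝ) / s) with hρ
  have hns : 1 ≤ (n : ℝ) / s := by rw [one_le_div hs0]; exact_mod_cast hsn
  have hρ1 : 1 ≤ ρ := Real.one_le_sqrt.2 hns
  have hρ2 : ρ ^ 2 = (n : ℝ) / s := Real.sq_sqrt (by positivity)
  have hP' : ∀ k < iterBound f x₀ M ε, ∀ u : E s,
      ‖Matrix.toEuclideanLin (P k)ᵀ u‖ ≤ (ρ + 336) * ‖u‖ := hP
  have hex := exists_short_direction hf hb hM hM0 hε (by positivity) hδ hΔ hP' hy h0 hstep
  obtain ⟨hkU, hkd⟩ := Nat.find_spec hex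
  set k := Nat.find hex with hk
  have hmin : ∀ j < k, Δ < ‖direction (P j) (y j)‖ := fun j hj => by
    by_contra hcon
    exact Nat.find_min hex hj ⟨hj.trans hkU, not_lt.1 hcon⟩
  have hΔ0 : 0 ≤ Δ := by rw [hΔ]; positivity
  -- From `ε ≤ M² / 8`, since `1/8 < (9/25)²`.
  have hσM : √ε ≤ 9 / 25 * M := by
    rw [Real.sqrt_le_left (by positivity)]
    nlinarith [sq_nonneg (M : ℝ)]
  have hΔ1 : Δ ≤ 9 / 25 := by
    rw [hΔ, div_le_iff₀ hM0]; exact hσM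
  have hgrad := norm_gradient_le_of_stop hf hL hσ (by linarith : (1 : ℝ) ≤ ρ + 336) hδ hΔ0 hΔ1
    (hP' k hkU) (hg k hkU) (hy k) hkd
  have hc0 : 0 ≤ c ^ (τ / 2) := by positivity
  have hscale : ρ ^ 2 * √ε ≤ c ^ (τ / 2) * (((n : ℝ) / s) ^ ((2 + τ) / 2) * ε) := by
    have h1 := sqrt_le_of_le_mul_rpow hs hsn hc hτ hε hsc
    have h2 : ((n : ℝ) / s) ^ ((2 + τ) / 2) = (n : ℝ) / s * ((n : ℝ) / s) ^ (τ / 2) := by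
      rw [show (2 + τ) / 2 = 1 + τ / 2 by ring, Real.rpow_add (by positivity), Real.rpow_one]
    calc ρ ^ 2 * √ε ≤ (n : ℝ) / s * (c ^ (τ / 2) * ((n : ℝ) / s) ^ (τ / 2) * ε) := by
          rw [hρ2]; gcongr
      _ = _ := by rw [h2]; ring
  set K₁ : ℝ := 250 * 337 ^ 2 * (2 * L + M) / M with hK₁
  have hK₁0 : 0 ≤ K₁ := by positivity
  have hLM : (0 : ℝ) ≤ L / M := by positivity
  have hgrad1 : ‖gradient f (x k)‖ ≤ K₁ * (ρ ^ 2 * √ε) := by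
    calc ‖gradient f (x k)‖ ≤ 250 * (2 * L + √ε) * (ρ + 336) ^ 2 * Δ := hgrad
      -- Uses `√ε ≤ M` and `ρ ≥ 1`.
      _ ≤ 250 * (2 * L + M) * (337 * ρ) ^ 2 * Δ := by
          gcongr
          · linarith
          · linarith
      _ = _ := by rw [hΔ, hK₁]; ring
  have hgrad2 : ‖gradient f (x (k + 1))‖ ≤ (K₁ + L / M) * (ρ ^ 2 * √ε) := by
    have h1 : ‖gradient f (x (k + 1)) - gradient f (x k)‖ ≤ L * Δ := by
      have h2 := hL.dist_le_mul (x (k + 1)) (x k)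
      rw [dist_eq_norm, dist_eq_norm, hstep, nextIterate, if_neg (not_lt.2 hkd),
        add_sub_cancel_left] at h2
      rw [hstep, nextIterate, if_neg (not_lt.2 hkd)]
      exact h2.trans (by gcongr)
    have h3 : L * Δ ≤ L / M * (ρ ^ 2 * √ε) := by
      rw [hΔ, show (L : ℝ) * (√ε / M) = L / M * (1 * √ε) by ring]
      gcongr
      exact one_le_pow₀ hρ1
    have h4 := norm_le_norm_add_norm_sub (gradient f (x k)) (gradient f (x (k + 1)))
    rw [norm_sub_rev] at h4
    linarith
  have hfin : (K₁ + L / M) * (ρ ^ 2 * √ε) ≤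
      ((K₁ + L / M) * c ^ (τ / 2) + 1) * ((n : ℝ) / s) ^ ((2 + τ) / 2) * ε := by
    have h1 : (K₁ + L / M) * (ρ ^ 2 * √ε) ≤
        (K₁ + L / M) * (c ^ (τ / 2) * (((n : ℝ) / s) ^ ((2 + τ) / 2) * ε)) := by gcongr
    have h2 : 0 ≤ ((n : ℝ) / s) ^ ((2 + τ) / 2) * ε := by positivity
    linarith
  refine ⟨k, hkU, ⟨hmin, hkd⟩, ?_, hgrad2.trans hfin⟩
  refine (hgrad1.trans ?_).trans hfin
  have h5 : 0 ≤ ρ ^ 2 * √ε := by positivity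
  nlinarith

/-- Per iteration, `exp (-s) / 2` for the operator norm and `3 exp (-s) / 2` for the gradient;
solver failures form a null set. -/
theorem IsRun.measure_exceptional_le {Ω : Type*} [mΩ : MeasurableSpace Ω] {μ : Measure Ω}
    [IsProbabilityMeasure μ] {ℱ : Filtration ℕ mΩ} {P : ℕ → Ω → Matrix (Fin s) (Fin n) ℝ}
    {y : ℕ → Ω → Hom s} {x : ℕ → Ω → E n} (h : IsRun μ ℱ f δ Δ x₀ P y x) (hs : 6 ≤ s)
    (hsn : s ≤ n) (hf : Continuous (gradient f)) (U : ℕ) :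
    μ.real {ω | ¬((∀ k < U, ∀ u : E s,
        ‖(WithLp.toLp 2 ((P k ω)ᵀ *ᵥ u.ofLp) : E n)‖ ≤ (√((n : ℝ) / s) + 336) * ‖u‖) ∧
      (∀ k < U, (gradient f (x k ω), P k ω) ∉ sketchFailure s n) ∧
      ∀ k, IsSubproblemSolution f δ (x k ω) (P k ω) (y k ω))} ≤ U * (2 * Real.exp (-s)) := by
  obtain ⟨A, hA, hAle, hAP⟩ := exists_norm_transpose_le (by omega : 1 ≤ s) hsn
  have hnull : μ.real {ω | ¬∀ k, IsSubproblemSolution f δ (x k ω) (P k ω) (y k ω)} = 0 := by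
    rw [measureReal_def, ENNReal.toReal_eq_zero_iff]
    left
    exact ae_all_iff.2 h.solution
  set Z := {ω | ¬∀ k, IsSubproblemSolution f δ (x k ω) (P k ω) (y k ω)} with hZ
  set W : ℕ → Set Ω := fun k => {ω | P k ω ∈ A} ∪
    {ω | (gradient f (x k ω), P k ω) ∈ sketchFailure s n} with hW
  have hWle : ∀ k, μ.real (W k) ≤ 2 * Real.exp (-s) := fun k => by
    have h1 := h.measure_matrix_mem k hA
    have h2 := h.measure_sketchFailure_le hs hsn hf k
    have h3 := measureReal_union_le (μ := μ) {ω | P k ω ∈ A}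
      {ω | (gradient f (x k ω), P k ω) ∈ sketchFailure s n}
    linarith
  have hsub : {ω | ¬((∀ k < U, ∀ u : E s,
        ‖(WithLp.toLp 2 ((P k ω)ᵀ *ᵥ u.ofLp) : E n)‖ ≤ (√((n : ℝ) / s) + 336) * ‖u‖) ∧
      (∀ k < U, (gradient f (x k ω), P k ω) ∉ sketchFailure s n) ∧
      ∀ k, IsSubproblemSolution f δ (x k ω) (P k ω) (y k ω))} ⊆
      Z ∪ ⋃ k ∈ Finset.range U, W k := by
    intro ω hω
    by_contra hcon
    simp only [Set.mem_union, Set.mem_iUnion, Finset.mem_range, not_or, not_exists, hZ, hW,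
      Set.mem_ofPred_eq, not_not] at hcon
    exact hω ⟨fun k hk => hAP _ (hcon.2 k hk).1, fun k hk => (hcon.2 k hk).2, hcon.1⟩
  calc _ ≤ _ := measureReal_mono hsub
    _ ≤ μ.real Z + μ.real (⋃ k ∈ Finset.range U, W k) := measureReal_union_le _ _
    _ ≤ 0 + ∑ k ∈ Finset.range U, μ.real (W k) := by
        rw [hnull]; gcongr; exact measureReal_biUnion_finset_le _ _
    _ ≤ 0 + ∑ _k ∈ Finset.range U, 2 * Real.exp (-s) := by gcongr; exact hWle _
    _ = _ := by simp

end Runs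

end RSHTR

theorem theorem1 :
    ∃ 𝒞 C : ℝ, 0 < 𝒞 ∧ 0 < C ∧
      ∀ (L M : ℝ≥0) (c τ : ℝ), 0 < c → 0 < τ →
      ∃ K : ℝ, 0 < K ∧
      ∀ (n s : ℕ) (f : RSHTR.E n → ℝ) (x₀ : RSHTR.E n) (ε δ Δ : ℝ),
        1 ≤ s → s ≤ n →
        ContDiff ℝ 2 f →
        BddBelow (Set.range f) →
        LipschitzWith L (gradient f) →
        LipschitzWith M (fderiv ℝ (gradient f)) →
        0 < ε → ε ≤ (M : ℝ) ^ 2 / 8 →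
        δ = (√((n : ℝ) / s) + 𝒞) ^ 2 * √ε →
        Δ = √ε / M →
        (s : ℝ) ≤ c * (n * ε ^ (1 / τ)) →
        (RSHTR.iterBound f x₀ M ε : ℝ) ≤
            (3 * (M : ℝ) ^ 2 * (f x₀ - ⨅ z, f z) + ((M : ℝ) ^ 2 / 8) ^ (3 / 2 : ℝ)) *
              ε ^ (-(3 / 2) : ℝ) ∧
        ∀ (Ω : Type*) [mΩ : MeasurableSpace Ω] (μ : Measure Ω) [IsProbabilityMeasure μ]
          (ℱ : Filtration ℕ mΩ) (P : ℕ → Ω → Matrix (Fin s) (Fin n) ℝ)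
          (y : ℕ → Ω → RSHTR.Hom s) (x : ℕ → Ω → RSHTR.E n),
          RSHTR.IsRun μ ℱ f δ Δ x₀ P y x →
          1 - 4 * Real.exp (-C * s / 4)
              - (2 * (RSHTR.iterBound f x₀ M ε : ℝ) + 2) * Real.exp (-(s : ℝ)) ≤
            μ.real {ω | ∃ k < RSHTR.iterBound f x₀ M ε,
              RSHTR.StopsAt Δ (fun j => P j ω) (fun j => y j ω) k ∧
              ‖gradient f (x k ω)‖ ≤ K * ((n : ℝ) / s) ^ ((2 + τ) / 2) * ε ∧
              ‖gradient f (x (k + 1) ω)‖ ≤ K * ((n : ℝ) / s) ^ ((2 + τ) / 2) * ε} := by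
  -- The final `+ 1` keeps the constant positive when `M = 0`, where the quotients by `M` are `0` by
  -- convention.
  refine ⟨336, 1 / 2, by norm_num, by norm_num, fun L M c τ hc hτ =>
    ⟨(250 * 337 ^ 2 * (2 * L + M) / M + L / M) * c ^ (τ / 2) + 1, by positivity, ?_⟩⟩
  intro n s f x₀ ε δ Δ hs hsn hf hb hL hM hε hεM hδ hΔ hsc
  refine ⟨RSHTR.iterBound_le hb hε hεM, ?_⟩
  intro Ω mΩ μ _ ℱ P y x hrun
  have hexp := Real.exp_pos (-(s : ℝ))
  rcases Nat.lt_or_ge s 6 with hs6 | hs6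
  -- For `s ≤ 5` the claim is vacuous: `4 exp (-s/8) ≥ 4 (1 - 5/8) > 1`.
  · refine le_trans ?_ measureReal_nonneg
    have h1 := Real.add_one_le_exp (-(1 / 2) * (s : ℝ) / 4)
    have h2 : (s : ℝ) ≤ 5 := by exact_mod_cast (by omega : s ≤ 5)
    have h3 : 0 ≤ (2 * (RSHTR.iterBound f x₀ M ε : ℝ) + 2) * Real.exp (-(s : ℝ)) := by positivity
    linarith
  · have hbad := hrun.measure_exceptional_le hs6 hsn hL.continuous (RSHTR.iterBound f x₀ M ε)
    set G := {ω | ∃ k < RSHTR.iterBound f x₀ M ε,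
      RSHTR.StopsAt Δ (fun j => P j ω) (fun j => y j ω) k ∧
      ‖gradient f (x k ω)‖ ≤ ((250 * 337 ^ 2 * (2 * L + M) / M + L / M) * c ^ (τ / 2) + 1) *
        ((n : ℝ) / s) ^ ((2 + τ) / 2) * ε ∧
      ‖gradient f (x (k + 1) ω)‖ ≤ ((250 * 337 ^ 2 * (2 * L + M) / M + L / M) * c ^ (τ / 2) + 1) *
        ((n : ℝ) / s) ^ ((2 + τ) / 2) * ε} with hG
    set Z := {ω | ¬((∀ k < RSHTR.iterBound f x₀ M ε, ∀ u : RSHTR.E s,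
        ‖(WithLp.toLp 2 ((P k ω)ᵀ *ᵥ u.ofLp) : RSHTR.E n)‖ ≤
          (√((n : ℝ) / s) + 336) * ‖u‖) ∧
      (∀ k < RSHTR.iterBound f x₀ M ε,
        (gradient f (x k ω), P k ω) ∉ RSHTR.sketchFailure s n) ∧
      ∀ k, RSHTR.IsSubproblemSolution f δ (x k ω) (P k ω) (y k ω))} with hZ
    have hcover : Set.univ ⊆ G ∪ Z := by
      intro ω _
      by_cases hω : ω ∈ Z
      · exact Or.inr hω
      · left
        simp only [hZ, Set.mem_ofPred_eq, not_not] at hω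
        exact RSHTR.exists_stopsAt hs hsn hc hτ hf hb hL hM hε hεM hδ hΔ hsc hω.1 hω.2.1 hω.2.2
          (hrun.init ω) (fun k => hrun.step k ω)
    have h1 : 1 ≤ μ.real G + μ.real Z := by
      have h2 := (measureReal_mono (μ := μ) hcover).trans (measureReal_union_le G Z)
      rwa [probReal_univ] at h2
    have h3 := Real.exp_pos (-(1 / 2) * (s : ℝ) / 4)
    linarith
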